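/- Logarithms are to base $2$. A circuit of depth $d$ on a finite set of qubits is a sequence of $d$ layers; a layer consists of gates acting on pairwise disjoint sets of qubits, and any two qubits may interact. Gates are arbitrary single-qubit and two-qubit unitaries; a circuit is *over CNOT and single-qubit gates* if all its gates are CNOT gates or single-qubit gates. For an operator $U$ on $n$ qubits, Control-$U$ is the operator $|0\rangle|\varphi\rangle\mapsto|0\rangle|\varphi\rangle$, $|1\rangle|\varphi\rangle\mapsto|1\rangle U|\varphi\rangle$ on $1+n$ qubits. A circuit *implements an operator on $1+n$ qubits with $s-1$ ancillas* if it acts on the $1+n$ qubits and $s-1$ further qubits ($n+s$ qubits in total) and, whenever the ancillas start in $|0^{s-1}\rangle$, performs the operator exactly and returns the ancillas to $|0^{s-1}\rangle$. For an integer $j\ge 0$, a circuit for the Hadamard test of $\{|0^n\rangle,U\}$ with phase gate $S^j$, $S=\mathrm{diag}(1,i)$, is a circuit that implements, with $s-1$ ancillas, the operator: Hadamard gate on the control qubit, then Control-$U$, then $S^j$ and then a Hadamard gate on the control qubit; and for which, when run on the all-zero state, measuring the control qubit in the computational basis gives the outcome $0$ with probability $$\Pr(0)=\tfrac12\bigl(1+\mathrm{Re}(i^{\,j}\langle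 0^n|U|0^n\rangle)\bigr).$$ (So $\Pr(0)=\frac12(1+\mathrm{Re}\langle 0^n|U|0^n\rangle)$ for $j=0$, $\frac12(1-\mathrm{Im}\langle 0^n|U|0^n\rangle)$ for $j=1$, and $\frac12(1+\mathrm{Im}\langle 0^n|U|0^n\rangle)$ for $j=3$, i.e. for $S^3=S^\dagger$.) **Theorem.** There is an absolute constant $K$ such that for all integers $n$, $s$, $d\ge 0$ with $1\le s\le n$ the following hold. 1. $2\lceil\log s\rceil+12d\lceil\log\frac ns\rceil+9d\le K\bigl(\log s+d\log\frac ns+d\bigr)$. 2. Let $\mathcal C$ be an $n$-qubit circuit of depth $d$ over CNOT and single-qubit gates. Then Control-$\mathcal C$ is implemented with $s-1$ ancillas by a circuit over CNOT and single-qubit gates of depth at most $$2\lceil\log s\rceil+12d\lceil\log\tfrac ns\rceil+9d .$$ Moreover, for every $j\ge 0$ there is a circuit over CNOT and single-qubit gates on these $n+s$ qubits, of depth at most $2\lceil\log s\rceil+12d\lceil\log\frac ns\rceil+9d+2$, for the Hadamard test of $\{|0^n\rangle,\mathcal C\}$ with phase gate $S^j$. 3. Let $\mathcal C$ be an $n$-qubit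 circuit of depth $d$ with arbitrary single-qubit and two-qubit gates. Then Control-$\mathcal C$ is implemented with $s-1$ ancillas by a circuit over CNOT and single-qubit gates of depth at most $K\bigl(\log s+d\log\frac ns+d\bigr)$. Moreover, if $d\ge1$, then for every $j\ge 0$ there is a circuit over CNOT and single-qubit gates on these $n+s$ qubits, of depth at most $K\bigl(\log s+d\log\frac ns+d\bigr)$, for the Hadamard test of $\{|0^n\rangle,\mathcal C\}$ with phase gate $S^j$. -/

import Mathlib

noncomputable section

/-- Computational basis states of a register whose qubits are indexed by `Q`. -/
abbrev QBasis (Q : Type) : Type := Q → Fin 2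

/-- (Unnormalized) state vectors of the register `Q`. -/
abbrev QState (Q : Type) : Type := QBasis Q → ℂ

/-- Operators on the register `Q`; rows index outputs and columns index inputs. -/
abbrev QOp (Q : Type) : Type := Matrix (QBasis Q) (QBasis Q) ℂ

/-- The CNOT matrix; the first qubit is the control, the second one the target:
`|a, b⟩ ↦ |a, b ⊕ a⟩`. -/
def cnotMatrix : Matrix (Fin 2 × Fin 2) (Fin 2 × Fin 2) ℂ :=
  fun x y => if x = (y.1, y.2 + y.1) then 1 else 0

/-- Gates on the register `Q`: an arbitrary unitary on one qubit, or an arbitrary unitary on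
two distinct qubits (all-to-all connectivity). -/
inductive QGate (Q : Type) : Type
  | one (q : Q) (U : Matrix.unitaryGroup (Fin 2) ℂ) : QGate Q
  | two (p q : Q) (hpq : p ≠ q) (U : Matrix.unitaryGroup (Fin 2 × Fin 2) ℂ) : QGate Q

namespace QGate

variable {Q : Type} [Fintype Q] [DecidableEq Q]

/-- The qubits on which a gate acts. -/
def support : QGate Q → Finset Q
  | one q _ => {q}
  | two p q _ _ => {p, q}

/-- The operator on the whole register: the gate on its qubits, the identity elsewhere. -/
def toMatrix : QGate Q → QOp Q
  | one q U => fun x y => if ∀ r, r ≠ q → x r = y r then U.1 (x q) (y q) else 0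
  | two p q _ U => fun x y =>
      if ∀ r, r ≠ p → r ≠ q → x r = y r then U.1 (x p, x q) (y p, y q) else 0

/-- The gate is a single-qubit gate or a CNOT gate (with any control and any target). -/
def IsCnotOrSingle : QGate Q → Prop
  | one _ _ => True
  | two _ _ _ U => U.1 = cnotMatrix

end QGate

/-- A one-layer circuit: finitely many gates acting on pairwise disjoint sets of qubits. -/
structure QLayer (Q : Type) [Fintype Q] [DecidableEq Q] : Type where
  gates : List (QGate Q)
  disjoint : gates.Pairwise fun g h => Disjoint g.support h.support

/-- The operator of a layer. The gates commute, so that their order is immaterial. -/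
def QLayer.toMatrix {Q : Type} [Fintype Q] [DecidableEq Q] (L : QLayer Q) : QOp Q :=
  (L.gates.map QGate.toMatrix).prod

/-- A circuit is a sequence of layers, the first layer of the list being applied first. -/
abbrev QCircuit (Q : Type) [Fintype Q] [DecidableEq Q] : Type := List (QLayer Q)

namespace QCircuit

variable {Q : Type} [Fintype Q] [DecidableEq Q]

/-- The depth is the number of layers. -/
def depth (C : QCircuit Q) : ℕ := List.length C

/-- The operator `C⁽ᵈ⁾ ⋯ C⁽¹⁾` of the circuit with layers `C⁽¹⁾, …, C⁽ᵈ⁾`. -/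
def toMatrix : QCircuit Q → QOp Q
  | [] => 1
  | L :: C => toMatrix C * L.toMatrix

/-- All gates of the circuit are CNOT gates or single-qubit gates. -/
def UsesCnotAndSingle (C : QCircuit Q) : Prop :=
  ∀ L : QLayer Q, L ∈ C → ∀ g ∈ L.gates, g.IsCnotOrSingle

end QCircuit

/-- One control qubit (on the left) together with `n` data qubits (on the right). -/
abbrev CtrlReg (n : ℕ) : Type := Unit ⊕ Fin n

/-- The control qubit, `a` ancilla qubits and `n` data qubits. -/
abbrev AncReg (a n : ℕ) : Type := Unit ⊕ (Fin a ⊕ Fin n)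

/-- With `s - 1` ancillas there are `n + s` qubits in total. -/
theorem card_ancReg (s n : ℕ) (hs : 1 ≤ s) : Fintype.card (AncReg (s - 1) n) = n + s := by
  simp only [Fintype.card_sum, Fintype.card_unit, Fintype.card_fin]
  omega

/-- The all-zero basis state `0…0`. -/
def zeroBasis (Q : Type) : QBasis Q := fun _ => 0

/-- The state vector `|0…0⟩`. -/
def zeroKet (Q : Type) [Fintype Q] [DecidableEq Q] : QState Q :=
  Pi.single (zeroBasis Q) 1

/-- The state obtained from a state `ψ` of the control and data qubits by adding `a` ancillas
in the state `|0^a⟩`. -/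
def addZeroAncillas (a : ℕ) {n : ℕ} (ψ : QState (CtrlReg n)) : QState (AncReg a n) :=
  fun x => if ∀ i : Fin a, x (Sum.inr (Sum.inl i)) = 0 then ψ (x ∘ Sum.map id Sum.inr) else 0

/-- The circuit `D` performs the operator `M` on the control and data qubits, with `a`
ancillas that start in `|0^a⟩` and are returned to `|0^a⟩`. -/
def Implements {a n : ℕ} (D : QCircuit (AncReg a n)) (M : QOp (CtrlReg n)) : Prop :=
  ∀ ψ : QState (CtrlReg n),
    D.toMatrix.mulVec (addZeroAncillas a ψ) = addZeroAncillas a (M.mulVec ψ)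

/-- Control-`U`: `|0⟩|φ⟩ ↦ |0⟩|φ⟩` and `|1⟩|φ⟩ ↦ |1⟩ U|φ⟩`. -/
def controlled {n : ℕ} (U : QOp (Fin n)) : QOp (CtrlReg n) := fun x y =>
  if x (Sum.inl ()) = y (Sum.inl ()) then
    (if y (Sum.inl ()) = 0 then (1 : QOp (Fin n)) else U) (x ∘ Sum.inr) (y ∘ Sum.inr)
  else 0

/-- The one-qubit operator `V` on the control qubit, tensored with the identity. -/
def onControl {n : ℕ} (V : Matrix (Fin 2) (Fin 2) ℂ) : QOp (CtrlReg n) := fun x y =>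
  if x ∘ Sum.inr = y ∘ Sum.inr then V (x (Sum.inl ())) (y (Sum.inl ())) else 0

/-- The Hadamard gate. -/
def hadamardGate : Matrix (Fin 2) (Fin 2) ℂ :=
  ((1 / Real.sqrt 2 : ℝ) : ℂ) • !![1, 1; 1, -1]

/-- The phase gate `S`. -/
def phaseGate : Matrix (Fin 2) (Fin 2) ℂ := !![1, 0; 0, Complex.I]

/-- The operator performed before the measurement in the Hadamard test of `{|0ⁿ⟩, U}`:
on the control qubit a Hadamard gate, then Control-`U`, then `Sʲ` and a Hadamard gate on the
control qubit. -/
def hadamardTestOp {n : ℕ} (U : QOp (Fin n)) (j : ℕ) : QOp (CtrlReg n) :=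
  onControl hadamardGate * onControl (phaseGate ^ j) * controlled U * onControl hadamardGate

/-- The probability of the outcome `0` when the circuit `T` is run on the all-zero state of all
the qubits and then the control qubit is measured in the computational basis. -/
def probZero {a n : ℕ} (T : QCircuit (AncReg a n)) : ℝ :=
  ∑ x : QBasis (AncReg a n),
    if x (Sum.inl ()) = 0 then ‖T.toMatrix.mulVec (zeroKet (AncReg a n)) x‖ ^ 2 else 0

/-- `T` is a circuit for the Hadamard test of `{|0ⁿ⟩, U}` with phase gate `Sʲ`: it performs the
operator of the test, and the outcome `0` has probability `(1 + Re (iʲ ⟨0ⁿ|U|0ⁿ⟩)) / 2`. -/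
def IsHadamardTest {a n : ℕ} (T : QCircuit (AncReg a n)) (U : QOp (Fin n)) (j : ℕ) : Prop :=
  Implements T (hadamardTestOp U j) ∧
    probZero T = (1 + (Complex.I ^ j * U (zeroBasis (Fin n)) (zeroBasis (Fin n))).re) / 2

/-- The depth `2⌈log s⌉ + 12 d ⌈log (n/s)⌉ + 9 d`, with logarithms to base two. -/
def controlDepth (n s d : ℕ) : ℕ :=
  2 * ⌈Real.logb 2 (s : ℝ)⌉₊ + 12 * d * ⌈Real.logb 2 ((n : ℝ) / (s : ℝ))⌉₊ + 9 * d

/-- The rate `log s + d log (n/s) + d`, with logarithms to base two. -/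
def depthRate (n s d : ℕ) : ℝ :=
  Real.logb 2 (s : ℝ) + (d : ℝ) * Real.logb 2 ((n : ℝ) / (s : ℝ)) + (d : ℝ)

end

/-!
Configurations of registers are accessed through lenses, so that a gate acts as `l.op U` for the
lens `l` of its qubits.

A one-qubit gate is `z A X B X C` with `A B C = 1`, and CNOT has an analogous template, so it is
enough to control the `X` gates and phases of a constant number of stages. The control bit is first
copied to the `s - 1` ancillas by `⌈log s⌉` layers of CNOT gates. The `s` copies then control `s` of
the `X` gates of a stage at once, and conjugation by a layer of CNOT gates doubles the number of
wires served, so that a stage costs `2⌈log (n/s)⌉ + 1` layers and a layer of the circuit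
`8⌈log (n/s)⌉ + 9`; afterwards the copies are undone.

Arbitrary two-qubit gates are first written as products of 35 elementary gates: two rounds of
multiplexed one-qubit gates bring the first and third columns of the unitary to diagonal form, which
leaves a multiplexer.
-/

noncomputable section Lenses

/-- A lawful lens: a component of type `B` of the configurations in `X`, which can be read and
overwritten. Qubits, pairs of qubits and subregisters are lenses on `QBasis Q`, so that gates and
embedded circuits are all instances of `QLens.op`. -/
@[ext]
structure QLens (X B : Type*) where
  get : X → B
  set : B → X → X
  get_set : ∀ b x, get (set b x) = b
  set_get : ∀ x, set (get x) x = x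
  set_set : ∀ b b' x, set b (set b' x) = set b x

namespace QLens

variable {X B C : Type*}

theorem set_eq_iff (l : QLens X B) {x y : X} :
    l.set (l.get y) x = y ↔ l.set (l.get x) y = x := by
  constructor <;> intro h <;> rw [← h, l.set_set, l.set_get]

section op

variable [Fintype X] [DecidableEq X] [Fintype B]

theorem sum_ite_set_eq (l : QLens X B) (f : X → ℂ) (x : X) :
    ∑ y, (if l.set (l.get y) x = y then f y else 0) = ∑ b, f (l.set b x) := by
  rw [← Finset.sum_filter]
  refine Finset.sum_bij' (fun y _ => l.get y) (fun b _ => l.set b x) ?_ ?_ ?_ ?_ ?_ <;>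
    simp +contextual [l.get_set]

/-- The operator `M` on the component seen by the lens, tensored with the identity, as a linear
function of `M`. -/
def opLinear (l : QLens X B) : Matrix B B ℂ →ₗ[ℂ] Matrix X X ℂ where
  toFun M := Matrix.of fun x y => if l.set (l.get y) x = y then M (l.get x) (l.get y) else 0
  map_add' M N := by ext; simp [ite_add_ite]
  map_smul' c M := by ext; simp

theorem opLinear_mulVec (l : QLens X B) (M : Matrix B B ℂ) (ψ : X → ℂ) (x : X) :
    (l.opLinear M).mulVec ψ x = ∑ b, M (l.get x) b * ψ (l.set b x) := by
  simp [Matrix.mulVec, dotProduct, opLinear, ite_mul, l.sum_ite_set_eq, l.get_set]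

variable [DecidableEq B]

/-- The operator `M` on the component seen by the lens, tensored with the identity. -/
def op (l : QLens X B) : Matrix B B ℂ →⋆ₐ[ℂ] Matrix X X ℂ where
  __ := AlgHom.ofLinearMap l.opLinear
    (Matrix.mulVec_injective <| funext fun ψ => funext fun x => by
      simp [opLinear_mulVec, Matrix.one_apply, l.set_get])
    (fun M N => Matrix.mulVec_injective <| funext fun ψ => funext fun x => by
      simp only [← Matrix.mulVec_mulVec, opLinear_mulVec, l.get_set, l.set_set, Matrix.mul_apply,
        Finset.sum_mul, Finset.mul_sum, mul_assoc]
      exact Finset.sum_comm)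
  map_star' M := by
    ext x y
    change (if _ then star M _ _ else 0) = star (if _ then M _ _ else 0)
    rw [apply_ite star, star_zero]
    exact if_congr l.set_eq_iff (Matrix.star_apply _ _ _) rfl

theorem op_apply (l : QLens X B) (M : Matrix B B ℂ) (x y : X) :
    l.op M x y = if l.set (l.get y) x = y then M (l.get x) (l.get y) else 0 := rfl

theorem op_mulVec (l : QLens X B) (M : Matrix B B ℂ) (ψ : X → ℂ) (x : X) :
    (l.op M).mulVec ψ x = ∑ b, M (l.get x) b * ψ (l.set b x) :=
  l.opLinear_mulVec M ψ x

/-- `QLens.op` on unitaries. -/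
def opUnitary (l : QLens X B) : Matrix.unitaryGroup B ℂ →* Matrix.unitaryGroup X ℂ where
  toFun U := ⟨l.op U.1, Unitary.map_mem l.op U.2⟩
  map_one' := Subtype.ext (map_one l.op)
  map_mul' U V := Subtype.ext (map_mul l.op U.1 V.1)

theorem coe_opUnitary (l : QLens X B) (U : Matrix.unitaryGroup B ℂ) :
    (l.opUnitary U).1 = l.op U.1 := rfl

variable [Fintype C] [DecidableEq C]

theorem commute_op (l : QLens X B) (m : QLens X C)
    (h : ∀ b c x, l.set b (m.set c x) = m.set c (l.set b x))
    (M : Matrix B B ℂ) (N : Matrix C C ℂ) : Commute (l.op M) (m.op N) := by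
  have get_set_right : ∀ c x, l.get (m.set c x) = l.get x := fun c x => by
    simpa only [l.set_get, l.get_set] using (congrArg l.get (h (l.get x) c x)).symm
  have get_set_left : ∀ b x, m.get (l.set b x) = m.get x := fun b x => by
    simpa only [m.set_get, m.get_set] using congrArg m.get (h b (m.get x) x)
  refine Matrix.mulVec_injective (funext fun ψ => funext fun x => ?_)
  simp only [← Matrix.mulVec_mulVec, op_mulVec, get_set_right, get_set_left, Finset.mul_sum, h]
  rw [Finset.sum_comm]
  simp only [mul_left_comm]

/-- The composite lens. -/
def comp (l : QLens X B) (m : QLens B C) : QLens X C where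
  get x := m.get (l.get x)
  set c x := l.set (m.set c (l.get x)) x
  get_set c x := by rw [l.get_set, m.get_set]
  set_get x := by rw [m.set_get, l.set_get]
  set_set c c' x := by rw [l.get_set, m.set_set, l.set_set]

theorem op_comp (l : QLens X B) (m : QLens B C) (M : Matrix C C ℂ) :
    (l.comp m).op M = l.op (m.op M) := by
  refine Matrix.mulVec_injective (funext fun ψ => funext fun x => ?_)
  simp only [op_mulVec, op_apply, comp, ite_mul, zero_mul, m.sum_ite_set_eq, m.get_set]

theorem opUnitary_comp (l : QLens X B) (m : QLens B C) (U : Matrix.unitaryGroup C ℂ) :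
    (l.comp m).opUnitary U = l.opUnitary (m.opUnitary U) :=
  Subtype.ext (l.op_comp m U.1)

end op

/-- One qubit of a register. -/
def qubit {Q : Type*} [DecidableEq Q] (q : Q) : QLens (Q → Fin 2) (Fin 2) where
  get x := x q
  set b x := Function.update x q b
  get_set b x := by simp
  set_get x := by simp
  set_set b b' x := by simp

/-- An ordered pair of distinct qubits of a register. -/
def pair {Q : Type*} [DecidableEq Q] {p q : Q} (h : p ≠ q) :
    QLens (Q → Fin 2) (Fin 2 × Fin 2) where
  get x := (x p, x q)
  set b x := Function.update (Function.update x p b.1) q b.2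
  get_set b x := by simp [Function.update_of_ne h]
  set_get x := by simp
  set_set b b' x := by
    rw [Function.update_comm h, Function.update_idem, Function.update_comm h.symm,
      Function.update_idem]

/-- The qubits in the range of an injection. -/
def subregister {P Q : Type*} {δ : P → Q} (h : Function.Injective δ) :
    QLens (Q → Fin 2) (P → Fin 2) where
  get x := x ∘ δ
  set u x := Function.extend δ u x
  get_set u x := funext (h.extend_apply u x)
  set_get x := funext fun r => by
    by_cases hr : ∃ i, δ i = r
    · obtain ⟨i, rfl⟩ := hr
      exact h.extend_apply _ _ i
    · exact Function.extend_apply' _ _ _ hr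
  set_set u u' x := funext fun r => by
    by_cases hr : ∃ i, δ i = r
    · obtain ⟨i, rfl⟩ := hr
      simp only [h.extend_apply]
    · simp only [Function.extend_apply' _ _ _ hr]

/-- The first component of a pair. -/
def first : QLens (B × C) B where
  get x := x.1
  set b x := (b, x.2)
  get_set _ _ := rfl
  set_get _ := rfl
  set_set _ _ _ := rfl

/-- The second component of a pair. -/
def second : QLens (B × C) C where
  get x := x.2
  set c x := (x.1, c)
  get_set _ _ := rfl
  set_get _ := rfl
  set_set _ _ _ := rfl

/-- A pair with its components exchanged. -/
def exchange : QLens (B × C) (C × B) where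
  get x := x.swap
  set b _ := b.swap
  get_set _ _ := rfl
  set_get _ := rfl
  set_set _ _ _ := rfl

section

variable {Q : Type*} [DecidableEq Q] {p q : Q}

theorem pair_comp_first (h : p ≠ q) : (pair h).comp first = qubit p := by
  ext <;> simp [comp, first, pair, qubit, Function.update_comm h]

theorem pair_comp_second (h : p ≠ q) : (pair h).comp second = qubit q := by
  ext <;> simp [comp, second, pair, qubit]

theorem pair_comp_exchange (h : p ≠ q) : (pair h).comp exchange = pair h.symm := by
  ext <;> simp [comp, exchange, pair, Function.update_comm h]

end

end QLens

end Lenses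

noncomputable section Operators

section Monoid

variable {ι κ M : Type*} [Monoid M]

theorem prod_map_mul_prod_map {l : List ι} {e f : ι → M}
    (h : l.Pairwise fun i j => Commute (e j) (f i)) :
    (l.map e).prod * (l.map f).prod = (l.map fun i => e i * f i).prod := by
  induction h with
  | nil => simp
  | @cons i l hi _ ih =>
    have hcomm : Commute (l.map e).prod (f i) :=
      Commute.list_prod_left _ _ (by simpa using hi)
    simp only [List.map_cons, List.prod_cons, ← ih]
    rw [mul_assoc, hcomm.left_comm, mul_assoc]

theorem prod_map_prod_map_comm {l : List ι} {M' : κ → ι → M}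
    (h : l.Pairwise fun i j => ∀ a b, Commute (M' a j) (M' b i)) (s : List κ) :
    (s.map fun a => (l.map (M' a)).prod).prod = (l.map fun i => (s.map (M' · i)).prod).prod := by
  induction s with
  | nil => simp
  | cons a s ih =>
    simp only [List.map_cons, List.prod_cons, ih]
    refine prod_map_mul_prod_map (h.imp fun hij => ?_)
    exact Commute.list_prod_right _ _ (by simpa using fun b _ => hij a b)

end Monoid

variable {Q : Type} [Fintype Q] [DecidableEq Q]

namespace QGate

theorem toMatrix_one (q : Q) (U : Matrix.unitaryGroup (Fin 2) ℂ) :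
    (one q U).toMatrix = (QLens.qubit q).op U.1 := by
  ext x y
  simp only [toMatrix, QLens.op_apply, QLens.qubit, Function.update_eq_iff, true_and]

theorem toMatrix_two {p q : Q} (h : p ≠ q) (U : Matrix.unitaryGroup (Fin 2 × Fin 2) ℂ) :
    (two p q h U).toMatrix = (QLens.pair h).op U.1 := by
  ext x y
  simp only [toMatrix, QLens.op_apply, QLens.pair, Function.update_eq_iff, true_and]
  refine if_congr (forall_congr' fun r => ?_) rfl rfl
  by_cases hr : r = p <;> simp [hr]

theorem toMatrix_mem_unitaryGroup (g : QGate Q) :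
    g.toMatrix ∈ Matrix.unitaryGroup (QBasis Q) ℂ := by
  cases g with
  | one q U => exact toMatrix_one q U ▸ ((QLens.qubit q).opUnitary U).2
  | two p q h U => exact toMatrix_two h U ▸ ((QLens.pair h).opUnitary U).2

theorem commute_toMatrix {g h : QGate Q} (hd : Disjoint g.support h.support) :
    Commute g.toMatrix h.toMatrix := by
  cases g <;> cases h <;>
    simp only [support, Finset.disjoint_left, Finset.mem_singleton, Finset.mem_insert] at hd <;>
    simp only [toMatrix_one, toMatrix_two] <;>
    refine QLens.commute_op _ _ (fun b c x => funext fun r => ?_) _ _ <;>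
    simp only [QLens.qubit, QLens.pair, Function.update_apply] <;>
    grind

theorem eq_of_toMatrix_ne_zero {g : QGate Q} {x y : QBasis Q} (h : g.toMatrix x y ≠ 0) {r : Q}
    (hr : r ∉ g.support) : x r = y r := by
  cases g with
  | one q U => exact (ite_ne_right_iff.1 h).1 r (by simpa [support] using hr)
  | two p q hpq U =>
    simp only [support, Finset.mem_insert, Finset.mem_singleton, not_or] at hr
    exact (ite_ne_right_iff.1 h).1 r hr.1 hr.2

end QGate

/-- The operators that act on the qubits in `S` only, generated by the gates within `S`. -/
def localAlgebra (S : Finset Q) : Subalgebra ℂ (QOp Q) :=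
  Algebra.adjoin ℂ {M | ∃ g : QGate Q, g.support ⊆ S ∧ g.toMatrix = M}

theorem QGate.toMatrix_mem_localAlgebra {g : QGate Q} {S : Finset Q} (h : g.support ⊆ S) :
    g.toMatrix ∈ localAlgebra S :=
  Algebra.subset_adjoin ⟨g, h, rfl⟩

theorem commute_of_mem_localAlgebra {S T : Finset Q} (h : Disjoint S T) {M N : QOp Q}
    (hM : M ∈ localAlgebra S) (hN : N ∈ localAlgebra T) : Commute M N := by
  refine Algebra.commute_of_mem_adjoin_of_forall_mem_commute hN ?_
  rintro _ ⟨g, hg, rfl⟩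
  refine (Algebra.commute_of_mem_adjoin_of_forall_mem_commute hM ?_).symm
  rintro _ ⟨f, hf, rfl⟩
  exact QGate.commute_toMatrix ((h.mono hf hg).symm)

/-- The projection onto the basis states that agree with `v` on the qubits in `K`. -/
def patternProj (K : Finset Q) (v : QBasis Q) : QOp Q :=
  Matrix.diagonal fun x => if ∀ q ∈ K, x q = v q then 1 else 0

theorem patternProj_mulVec (K : Finset Q) (v : QBasis Q) (ψ : QState Q) (x : QBasis Q) :
    (patternProj K v).mulVec ψ x = if ∀ q ∈ K, x q = v q then ψ x else 0 := by
  rw [patternProj, Matrix.mulVec_diagonal, ite_mul, one_mul, zero_mul]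

theorem patternProj_congr {K : Finset Q} {v w : QBasis Q} (h : ∀ q ∈ K, v q = w q) :
    patternProj K v = patternProj K w := by
  unfold patternProj
  congr! 5 with x q hq
  rw [h q hq]

theorem commute_patternProj {K : Finset Q} (v : QBasis Q) {M : QOp Q}
    (hM : M ∈ localAlgebra Kᶜ) : Commute M (patternProj K v) := by
  refine (Algebra.commute_of_mem_adjoin_of_forall_mem_commute hM ?_).symm
  rintro _ ⟨g, hg, rfl⟩
  ext x y
  rw [patternProj, Matrix.diagonal_mul, Matrix.mul_diagonal]
  by_cases hxy : g.toMatrix x y = 0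
  · simp [hxy]
  · have hK : ∀ q ∈ K, x q = y q := fun q hq =>
      QGate.eq_of_toMatrix_ne_zero hxy fun hq' => Finset.mem_compl.1 (hg hq') hq
    simp +contextual only [hK, mul_comm]

/-- The product of a list of gates; the last gate of the list is applied first. -/
def gatesOp (l : List (QGate Q)) : QOp Q := (l.map QGate.toMatrix).prod

@[simp] theorem gatesOp_nil : gatesOp ([] : List (QGate Q)) = 1 := rfl

@[simp] theorem gatesOp_cons (g : QGate Q) (l : List (QGate Q)) :
    gatesOp (g :: l) = g.toMatrix * gatesOp l := by
  simp [gatesOp]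

@[simp] theorem gatesOp_append (l l' : List (QGate Q)) :
    gatesOp (l ++ l') = gatesOp l * gatesOp l' := by
  simp [gatesOp]

theorem gatesOp_mem_localAlgebra {l : List (QGate Q)} {S : Finset Q}
    (h : ∀ g ∈ l, g.support ⊆ S) : gatesOp l ∈ localAlgebra S :=
  Subalgebra.list_prod_mem _ (by simpa using fun g hg => QGate.toMatrix_mem_localAlgebra (h g hg))

theorem commute_gatesOp {l l' : List (QGate Q)}
    (h : ∀ f ∈ l, ∀ g ∈ l', Disjoint f.support g.support) : Commute (gatesOp l) (gatesOp l') :=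
  Commute.list_prod_left _ _ <| List.forall_mem_map.2 fun f hf =>
    Commute.list_prod_right _ _ <| List.forall_mem_map.2 fun g hg =>
      QGate.commute_toMatrix (h f hf g hg)

namespace QCircuit

theorem toMatrix_append (C D : QCircuit Q) : toMatrix (C ++ D) = toMatrix D * toMatrix C := by
  induction C with
  | nil => simp [toMatrix]
  | cons L C ih => simp [toMatrix, ih, mul_assoc]

theorem toMatrix_singleton (L : QLayer Q) : toMatrix [L] = gatesOp L.gates :=
  one_mul _

theorem toMatrix_mem_unitaryGroup (C : QCircuit Q) :
    C.toMatrix ∈ Matrix.unitaryGroup (QBasis Q) ℂ := by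
  induction C with
  | nil => exact one_mem _
  | cons L C ih =>
    exact mul_mem ih (Submonoid.list_prod_mem _
      (by simpa using fun g _ => g.toMatrix_mem_unitaryGroup))

theorem depth_append (C D : QCircuit Q) : depth (C ++ D) = depth C + depth D :=
  List.length_append

theorem UsesCnotAndSingle.append {C D : QCircuit Q} (hC : C.UsesCnotAndSingle)
    (hD : D.UsesCnotAndSingle) : UsesCnotAndSingle (C ++ D) :=
  List.forall_mem_append.2 ⟨hC, hD⟩

end QCircuit

section RealizesOn

variable {β : Type*} {K : Finset Q} {v : β → QBasis Q} {k l : ℕ} {M N : β → QOp Q}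

/-- A circuit over CNOT and single-qubit gates of depth at most `k` performs `M b` on the qubits
outside `K` whenever the qubits in `K` are in the basis state `v b`, which it preserves. -/
def RealizesOn (K : Finset Q) (v : β → QBasis Q) (k : ℕ) (M : β → QOp Q) : Prop :=
  (∀ b, M b ∈ localAlgebra Kᶜ) ∧ ∃ D : QCircuit Q, D.UsesCnotAndSingle ∧ D.depth ≤ k ∧
    ∀ b, D.toMatrix * patternProj K (v b) = M b * patternProj K (v b)

namespace RealizesOn

theorem one : RealizesOn K v 0 fun _ => 1 :=
  ⟨fun _ => one_mem _, [], by simp [QCircuit.UsesCnotAndSingle], le_rfl,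
    fun _ => by rw [QCircuit.toMatrix]⟩

theorem comp (hM : RealizesOn K v k M) (hN : RealizesOn K v l N) :
    RealizesOn K v (k + l) fun b => N b * M b := by
  obtain ⟨hM, D, hD, hk, hDM⟩ := hM
  obtain ⟨hN, E, hE, hl, hEN⟩ := hN
  refine ⟨fun b => mul_mem (hN b) (hM b), D ++ E, hD.append hE,
    (QCircuit.depth_append D E).trans_le (add_le_add hk hl), fun b => ?_⟩
  have hcomm := (commute_patternProj (v b) (hM b)).eq
  rw [QCircuit.toMatrix_append, mul_assoc, hDM, hcomm, ← mul_assoc, hEN, mul_assoc, ← hcomm,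
    mul_assoc]

theorem of_layer (L : QLayer Q) (hL : ∀ g ∈ L.gates, g.IsCnotOrSingle)
    (hM : ∀ b, M b ∈ localAlgebra Kᶜ)
    (h : ∀ b, gatesOp L.gates * patternProj K (v b) = M b * patternProj K (v b)) :
    RealizesOn K v 1 M :=
  ⟨hM, [L], by simpa [QCircuit.UsesCnotAndSingle] using hL, le_rfl,
    fun b => QCircuit.toMatrix_singleton L ▸ h b⟩

end RealizesOn

end RealizesOn

end Operators

noncomputable section OneQubitGates

section

variable {ι : Type*} [Fintype ι]

theorem star_mul_self_apply_of_column_eq_zero {M : Matrix ι ι ℂ} {j : ι}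
    (h : ∀ i, i ≠ j → M i j = 0) (k : ι) : (star M * M) j k = star (M j j) * M j k := by
  rw [Matrix.mul_apply, Finset.sum_eq_single j (fun i _ hi => by simp [h i hi]) (by simp),
    Matrix.star_apply]

variable [DecidableEq ι]

theorem norm_apply_self_of_column_eq_zero (U : Matrix.unitaryGroup ι ℂ) {j : ι}
    (h : ∀ i, i ≠ j → U.1 i j = 0) : ‖U.1 j j‖ = 1 := by
  have hjj := star_mul_self_apply_of_column_eq_zero h j
  rw [Matrix.UnitaryGroup.star_mul_self, Matrix.one_apply_eq] at hjj
  exact CStarRing.norm_of_mem_unitary (Unitary.mem_iff_star_mul_self.2 hjj.symm)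

theorem row_eq_zero_of_column_eq_zero (U : Matrix.unitaryGroup ι ℂ) {j : ι}
    (h : ∀ i, i ≠ j → U.1 i j = 0) {k : ι} (hk : k ≠ j) : U.1 j k = 0 := by
  have hjk := star_mul_self_apply_of_column_eq_zero h k
  rw [Matrix.UnitaryGroup.star_mul_self, Matrix.one_apply_ne hk.symm] at hjk
  refine (mul_eq_zero.1 hjk.symm).resolve_left fun h0 => ?_
  have hnorm := norm_apply_self_of_column_eq_zero U h
  rw [star_eq_zero.1 h0, norm_zero] at hnorm
  exact zero_ne_one hnorm

end

/-- The one-qubit gate `diag(1, z)`. -/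
def phaseUnitary (z : Circle) : Matrix.unitaryGroup (Fin 2) ℂ :=
  ⟨!![1, 0; 0, (z : ℂ)], by
    have hz : (z : ℂ) * (starRingEnd ℂ) z = 1 := by
      rw [Complex.mul_conj, Circle.normSq_coe, Complex.ofReal_one]
    rw [Matrix.mem_unitaryGroup_iff]
    ext i j
    fin_cases i <;> fin_cases j <;> simp [Matrix.mul_apply, Matrix.star_apply, hz]⟩

theorem phaseUnitary_mul_inv (z : Circle) : phaseUnitary z * phaseUnitary z⁻¹ = 1 := by
  ext i j
  fin_cases i <;> fin_cases j <;> simp [phaseUnitary]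

/-- The Pauli `X` gate. -/
def pauliX : Matrix.unitaryGroup (Fin 2) ℂ :=
  ⟨!![0, 1; 1, 0], by
    rw [Matrix.mem_unitaryGroup_iff]
    ext i j
    fin_cases i <;> fin_cases j <;> simp [Matrix.mul_apply, Matrix.star_apply]⟩

/-- The Hadamard gate as a unitary. -/
def hadamardUnitary : Matrix.unitaryGroup (Fin 2) ℂ :=
  ⟨hadamardGate, by
    rw [Matrix.mem_unitaryGroup_iff]
    have h : ((Real.sqrt 2 : ℝ) : ℂ)⁻¹ * ((Real.sqrt 2 : ℝ) : ℂ)⁻¹ = 1 / 2 := by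
      rw [← mul_inv, ← Complex.ofReal_mul, Real.mul_self_sqrt (by norm_num)]
      norm_num
    ext i j
    fin_cases i <;> fin_cases j <;>
      simp [hadamardGate, Matrix.mul_apply, Matrix.star_apply, h] <;> norm_num⟩

/-- The CNOT gate as a unitary. -/
def cnotUnitary : Matrix.unitaryGroup (Fin 2 × Fin 2) ℂ :=
  ⟨cnotMatrix, by
    rw [Matrix.mem_unitaryGroup_iff]
    ext ⟨i, j⟩ ⟨k, l⟩
    fin_cases i <;> fin_cases j <;> fin_cases k <;> fin_cases l <;>
      simp [Matrix.mul_apply, Matrix.star_apply, cnotMatrix, Fintype.sum_prod_type]⟩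

theorem exists_unitary_mulVec_one_eq_zero (v : Fin 2 → ℂ) :
    ∃ W : Matrix.unitaryGroup (Fin 2) ℂ, (W.1.mulVec v) 1 = 0 := by
  obtain rfl | hv := eq_or_ne v 0
  · exact ⟨1, by simp⟩
  set r : ℝ := ‖v 0‖ ^ 2 + ‖v 1‖ ^ 2
  have hr : 0 < r := by
    obtain ⟨i, hi⟩ := Function.ne_iff.1 hv
    have hpos : 0 < ‖v i‖ := norm_pos_iff.2 hi
    fin_cases i <;> simp only [Fin.zero_eta, Fin.mk_one] at hpos <;> positivity
  have hsqrt : ((√r : ℝ) : ℂ) ≠ 0 := Complex.ofReal_ne_zero.2 (Real.sqrt_pos.2 hr).ne'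
  have hsum : v 0 * (starRingEnd ℂ) (v 0) + v 1 * (starRingEnd ℂ) (v 1) = √r * √r := by
    rw [← Complex.ofReal_mul, Real.mul_self_sqrt hr.le, Complex.mul_conj', Complex.mul_conj']
    push_cast [r]
    rfl
  -- The first row is proportional to `v̄`, so that the second one is orthogonal to `v`.
  refine ⟨⟨((√r : ℝ) : ℂ)⁻¹ •
    !![(starRingEnd ℂ) (v 0), (starRingEnd ℂ) (v 1); -v 1, v 0], ?_⟩, ?_⟩
  · rw [Matrix.mem_unitaryGroup_iff]
    ext i j
    fin_cases i <;> fin_cases j <;> simp [Matrix.mul_apply, Matrix.star_apply] <;> field_simp <;>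
      first | ring1 | linear_combination hsum
  · simp [Matrix.mulVec, dotProduct]
    ring

theorem exists_eq_smul_conj_phaseUnitary (U : Matrix.unitaryGroup (Fin 2) ℂ) :
    ∃ (V : Matrix.unitaryGroup (Fin 2) ℂ) (z w : Circle),
      U.1 = (z : ℂ) • (V * phaseUnitary w * V⁻¹).1 := by
  obtain ⟨l, hl⟩ := Module.End.exists_eigenvalue (Matrix.toLin' U.1)
  obtain ⟨v, hv⟩ := hl.exists_hasEigenvector
  obtain ⟨W, hW⟩ := exists_unitary_mulVec_one_eq_zero v
  set M := W * U * W⁻¹ with hM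
  have heigen : M.1.mulVec (W.1.mulVec v) = l • W.1.mulVec v := by
    rw [Matrix.mulVec_mulVec, ← Matrix.UnitaryGroup.mul_val, hM, inv_mul_cancel_right,
      Matrix.UnitaryGroup.mul_val, ← Matrix.mulVec_mulVec, ← Matrix.mulVec_smul]
    exact congrArg _ (by simpa using hv.apply_eq_smul)
  have hr : W.1.mulVec v 0 ≠ 0 := fun h0 => hv.2 <| by
    rw [← Matrix.one_mulVec v, ← Matrix.UnitaryGroup.star_mul_self W, ← Matrix.mulVec_mulVec]
    have hWv : W.1.mulVec v = 0 := by
      ext i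
      fin_cases i <;> assumption
    rw [hWv, Matrix.mulVec_zero]
  generalize W.1.mulVec v = u at heigen hr hW
  have h10 : M.1 1 0 = 0 := by
    simpa [Matrix.mulVec, dotProduct, hW, hr] using congrFun heigen 1
  have hcol : ∀ i, i ≠ 0 → M.1 i 0 = 0 := by simpa [Fin.forall_fin_two] using h10
  have h01 : M.1 0 1 = 0 := row_eq_zero_of_column_eq_zero M hcol one_ne_zero
  let z : Circle := ⟨M.1 0 0, mem_sphere_zero_iff_norm.2 (norm_apply_self_of_column_eq_zero M hcol)⟩
  let w : Circle := ⟨M.1 1 1, mem_sphere_zero_iff_norm.2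
    (norm_apply_self_of_column_eq_zero M (by simpa [Fin.forall_fin_two] using h01))⟩
  have hdiag : M.1 = (z : ℂ) • (phaseUnitary (z⁻¹ * w)).1 := by
    ext i j
    fin_cases i <;> fin_cases j <;> simp [phaseUnitary, h01, h10] <;> rfl
  refine ⟨W⁻¹, z, z⁻¹ * w, ?_⟩
  have hU : U = W⁻¹ * M * W := by rw [hM]; group
  rw [inv_inv, hU]
  simp only [Matrix.UnitaryGroup.mul_val, hdiag, Matrix.mul_smul, Matrix.smul_mul]

theorem exists_abc (U : Matrix.unitaryGroup (Fin 2) ℂ) :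
    ∃ (A B C : Matrix.unitaryGroup (Fin 2) ℂ) (z : Circle),
      A * B * C = 1 ∧ (z : ℂ) • (A * pauliX * B * pauliX * C).1 = U.1 := by
  obtain ⟨V, z, w, hU⟩ := exists_eq_smul_conj_phaseUnitary U
  obtain ⟨t, ht⟩ : ∃ t : Circle, t * t = w :=
    ⟨Circle.exp (Complex.arg w / 2), by rw [← Circle.exp_add, add_halves, Circle.exp_arg]⟩
  have hX : (t : ℂ) • (phaseUnitary t * pauliX * phaseUnitary t⁻¹ * pauliX).1
      = (phaseUnitary w).1 := by
    ext i j
    fin_cases i <;> fin_cases j <;>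
      simp [phaseUnitary, pauliX, ← ht]
  refine ⟨V * phaseUnitary t, phaseUnitary t⁻¹, V⁻¹, z * t, ?_, ?_⟩
  · rw [mul_assoc V, phaseUnitary_mul_inv, mul_one, mul_inv_cancel]
  · simp only [hU, Matrix.UnitaryGroup.mul_val, ← hX, Circle.coe_mul, mul_smul, Matrix.mul_smul,
      Matrix.smul_mul, mul_assoc]

/-- A primitive eighth root of unity. -/
def eighthRoot : Circle := Circle.exp (Real.pi / 4)

theorem eighthRoot_pow_four : (eighthRoot : ℂ) ^ 4 = -1 := by
  rw [eighthRoot, Circle.coe_exp, ← Complex.exp_nat_mul, ← Complex.exp_pi_mul_I]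
  congr 1
  push_cast
  ring

theorem cnotUnitary_mulVec (φ : Fin 2 × Fin 2 → ℂ) (x : Fin 2 × Fin 2) :
    cnotUnitary.1.mulVec φ x = φ (x.1, x.2 + x.1) := by
  obtain ⟨i, j⟩ := x
  fin_cases i <;> fin_cases j <;>
    simp [Matrix.mulVec, dotProduct, cnotUnitary, cnotMatrix, Fintype.sum_prod_type]

namespace QLens

section mulVec

variable {X : Type*} [Fintype X] [DecidableEq X] (l : QLens X (Fin 2)) (ψ : X → ℂ) (x : X)

theorem op_phaseUnitary_mulVec (z : Circle) :
    (l.op (phaseUnitary z).1).mulVec ψ x = (if l.get x = 0 then 1 else (z : ℂ)) * ψ x := by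
  have hx := l.set_get x
  rw [op_mulVec, Fin.sum_univ_two]
  generalize l.get x = i at hx
  fin_cases i <;> simp_all [phaseUnitary]

theorem op_pauliX_pow_mulVec (b : Fin 2) :
    (l.op (pauliX ^ b.val).1).mulVec ψ x = ψ (l.set (l.get x + b) x) := by
  rw [op_mulVec, Fin.sum_univ_two]
  generalize l.get x = i
  fin_cases b <;> fin_cases i <;> simp [pauliX]

theorem op_hadamardUnitary_mulVec :
    (l.op hadamardUnitary.1).mulVec ψ x = ((1 / Real.sqrt 2 : ℝ) : ℂ) *
      (ψ (l.set 0 x) + (if l.get x = 0 then 1 else -1) * ψ (l.set 1 x)) := by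
  rw [op_mulVec, Fin.sum_univ_two]
  generalize l.get x = i
  fin_cases i <;> simp [hadamardUnitary, hadamardGate] <;> ring

theorem op_cnotUnitary_mulVec (m : QLens X (Fin 2 × Fin 2)) :
    (m.op cnotUnitary.1).mulVec ψ x
      = ψ (m.set ((m.get x).1, (m.get x).2 + (m.get x).1) x) :=
  (m.op_mulVec _ ψ x).trans (cnotUnitary_mulVec (fun b => ψ (m.set b x)) (m.get x))

end mulVec

/-- Without the control the phases cancel. With the control, the `X` gates flip the sign of the
exponents of the phases, which then add up to `(-1) ^ (x₁ x₂)` times a global phase. -/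
theorem cnot_template (b : Fin 2) :
    ((eighthRoot ^ b.val : Circle) : ℂ) • (second.op hadamardUnitary.1 *
      first.op (pauliX ^ b.val).1 * first.op (phaseUnitary eighthRoot⁻¹).1 *
      exchange.op cnotUnitary.1 *
      (second.op (pauliX ^ b.val).1 * first.op (phaseUnitary eighthRoot).1) *
      (first.op (pauliX ^ b.val).1 * second.op (phaseUnitary eighthRoot⁻¹).1) *
      (second.op (pauliX ^ b.val).1 * first.op (phaseUnitary eighthRoot⁻¹).1) *
      exchange.op cnotUnitary.1 *
      (second.op (phaseUnitary eighthRoot * hadamardUnitary).1 *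
        first.op (phaseUnitary eighthRoot).1)) =
    if b = 0 then 1 else cnotUnitary.1 := by
  refine Matrix.mulVec_injective (funext fun ψ => funext fun x => ?_)
  have h : ((1 / Real.sqrt 2 : ℝ) : ℂ) ^ 2 = 1 / 2 := by
    rw [← Complex.ofReal_pow, div_pow, Real.sq_sqrt (by norm_num)]
    norm_num
  have h4 := eighthRoot_pow_four
  have hz : (eighthRoot : ℂ) ≠ 0 := Circle.coe_ne_zero _
  simp only [← Matrix.mulVec_mulVec, Matrix.smul_mulVec, Matrix.UnitaryGroup.mul_val, map_mul,
    Pi.smul_apply, smul_eq_mul, op_phaseUnitary_mulVec, op_pauliX_pow_mulVec,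
    op_hadamardUnitary_mulVec, op_cnotUnitary_mulVec, first, second, exchange, Prod.swap,
    Circle.coe_inv, Circle.coe_pow]
  generalize ((1 / Real.sqrt 2 : ℝ) : ℂ) = r at h
  generalize (eighthRoot : ℂ) = z at h4 hz
  obtain ⟨i, j⟩ := x
  fin_cases b <;> fin_cases i <;> fin_cases j <;> simp [hz, cnotUnitary_mulVec] <;>
    field_simp <;> rw [h] <;> try rw [h4]
  all_goals ring

end QLens

end OneQubitGates

noncomputable section ControlledLayers

variable {Q : Type} [DecidableEq Q]

namespace QGate

/-- The gate `X ^ b` on the qubit `q`. -/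
def xPow (b : Fin 2) (q : Q) : QGate Q := one q (pauliX ^ b.val)

@[simp] theorem support_xPow (b : Fin 2) (q : Q) : (xPow b q).support = {q} := rfl

/-- The CNOT gate with control `z.1` and target `z.2`; these are meant to be distinct, and the
gate is the identity otherwise. -/
def cnot (z : Q × Q) : QGate Q := if h : z.1 ≠ z.2 then two z.1 z.2 h cnotUnitary else one z.2 1

theorem pairwise_disjoint_pair {zs : List (Q × Q)}
    (h : (zs.map Prod.fst ++ zs.map Prod.snd).Nodup) :
    zs.Pairwise fun z w => Disjoint {z.1, z.2} ({w.1, w.2} : Finset Q) := by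
  obtain ⟨hfst, hsnd, hdisj⟩ := List.nodup_append'.1 h
  refine ((List.pairwise_map.1 hfst).and (List.pairwise_map.1 hsnd)).imp_of_mem
    fun {z w} hz hw hzw => ?_
  have hzw' : z.1 ≠ w.2 := fun heq =>
    hdisj (List.mem_map_of_mem hz) (heq ▸ List.mem_map_of_mem hw)
  have hwz : w.1 ≠ z.2 := fun heq =>
    hdisj (List.mem_map_of_mem hw) (heq ▸ List.mem_map_of_mem hz)
  simp [hzw.1.symm, hzw.2.symm, hzw'.symm, hwz]

theorem support_cnot_subset (z : Q × Q) : (cnot z).support ⊆ {z.1, z.2} := by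
  unfold cnot
  split_ifs <;> simp [support]

theorem pairwise_disjoint_support_cnot {zs : List (Q × Q)}
    (h : (zs.map Prod.fst ++ zs.map Prod.snd).Nodup) :
    (zs.map cnot).Pairwise fun f g => Disjoint f.support g.support :=
  List.pairwise_map.2 <| (pairwise_disjoint_pair h).imp fun hzw =>
    hzw.mono (support_cnot_subset _) (support_cnot_subset _)

theorem isCnotOrSingle_cnot (z : Q × Q) : (cnot z).IsCnotOrSingle := by
  unfold cnot
  split_ifs <;> simp [IsCnotOrSingle, cnotUnitary]

variable [Fintype Q]

theorem xPow_mulVec (b : Fin 2) (q : Q) (ψ : QState Q) (x : QBasis Q) :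
    (xPow b q).toMatrix.mulVec ψ x = ψ (Function.update x q (x q + b)) := by
  rw [xPow, toMatrix_one]
  exact QLens.op_pauliX_pow_mulVec _ ψ x b

theorem cnot_mulVec {z : Q × Q} (h : z.1 ≠ z.2) (ψ : QState Q) (x : QBasis Q) :
    (cnot z).toMatrix.mulVec ψ x = ψ (Function.update x z.2 (x z.2 + x z.1)) := by
  rw [cnot, dif_pos h, toMatrix_two, QLens.op_cnotUnitary_mulVec]
  simp [QLens.pair]

theorem cnot_mul_cnot (z : Q × Q) : (cnot z).toMatrix * (cnot z).toMatrix = 1 := by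
  by_cases h : z.1 = z.2
  · simp [cnot, h, toMatrix_one]
  · refine Matrix.mulVec_injective (funext fun ψ => funext fun x => ?_)
    have add_self : ∀ b : Fin 2, b + b = 0 := by decide
    simp only [← Matrix.mulVec_mulVec, cnot_mulVec h, Function.update_of_ne h, Function.update_self,
      Function.update_idem, add_assoc, add_self, add_zero, Function.update_eq_self,
      Matrix.one_mulVec]

theorem cnot_mul_xPow_mul_cnot {z : Q × Q} (h : z.1 ≠ z.2) (b : Fin 2) :
    (cnot z).toMatrix * (xPow b z.1).toMatrix * (cnot z).toMatrix
      = (xPow b z.1).toMatrix * (xPow b z.2).toMatrix := by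
  refine Matrix.mulVec_injective (funext fun ψ => funext fun x => ?_)
  have add_cancel : ∀ a c : Fin 2, c + a + (a + b) = c + b := by revert b; decide
  simp only [← Matrix.mulVec_mulVec, cnot_mulVec h, xPow_mulVec, Function.update_self,
    Function.update_of_ne h, Function.update_of_ne (Ne.symm h),
    Function.update_comm (Ne.symm h) _ _ x, Function.update_idem, add_cancel]

theorem cnot_mul_patternProj {K : Finset Q} {z : Q × Q} (h : z.1 ∈ K) (hK : z.2 ∉ K) (b : Fin 2) :
    (cnot z).toMatrix * patternProj K (fun _ => b)
      = (xPow b z.2).toMatrix * patternProj K (fun _ => b) := by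
  have hz : z.1 ≠ z.2 := ne_of_mem_of_not_mem h hK
  refine Matrix.mulVec_injective (funext fun ψ => funext fun x => ?_)
  have hne : ∀ c, (∀ q ∈ K, Function.update x z.2 c q = b) ↔ ∀ q ∈ K, x q = b := fun c =>
    forall₂_congr fun q hq => by rw [Function.update_of_ne (ne_of_mem_of_not_mem hq hK)]
  simp only [← Matrix.mulVec_mulVec, cnot_mulVec hz, xPow_mulVec, patternProj_mulVec, hne]
  exact ite_congr rfl (fun hx => by rw [hx _ h]) fun _ => rfl

theorem gatesOp_map_cnot_mul_patternProj {K : Finset Q} {zs : List (Q × Q)}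
    (h : ∀ z ∈ zs, z.1 ∈ K ∧ z.2 ∉ K) (b : Fin 2) :
    gatesOp (zs.map cnot) * patternProj K (fun _ => b)
      = gatesOp ((zs.map Prod.snd).map (xPow b)) * patternProj K (fun _ => b) := by
  induction zs with
  | nil => rfl
  | cons z zs ih =>
    obtain ⟨hz, hzs⟩ := List.forall_mem_cons.1 h
    have hcomm : Commute (gatesOp ((zs.map Prod.snd).map (xPow b)))
        (patternProj K fun _ => b) :=
      commute_patternProj _ (gatesOp_mem_localAlgebra
        (by simpa [@forall_comm (QGate Q)] using fun p q hq => (hzs (p, q) hq).2))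
    simp only [List.map_cons, gatesOp_cons, mul_assoc]
    rw [ih hzs, hcomm.eq, ← mul_assoc, cnot_mul_patternProj hz.1 hz.2, mul_assoc]

theorem gatesOp_conj_cnot {zs : List (Q × Q)}
    (h : (zs.map Prod.fst ++ zs.map Prod.snd).Nodup) (b : Fin 2) :
    gatesOp (zs.map cnot) * gatesOp ((zs.map Prod.fst).map (xPow b)) * gatesOp (zs.map cnot)
      = gatesOp ((zs.map Prod.fst).map (xPow b)) * gatesOp ((zs.map Prod.snd).map (xPow b)) := by
  have hdisj := pairwise_disjoint_pair h
  have hcnot : ∀ z ∈ zs, z.1 ≠ z.2 := fun z hz heq =>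
    (List.nodup_append'.1 h).2.2 (List.mem_map_of_mem hz) (heq ▸ List.mem_map_of_mem hz)
  simp only [gatesOp, List.map_map]
  rw [prod_map_mul_prod_map, prod_map_mul_prod_map, prod_map_mul_prod_map]
  · exact congrArg _ (List.map_congr_left fun z hz => cnot_mul_xPow_mul_cnot (hcnot z hz) b)
  · exact hdisj.imp fun hzw => commute_toMatrix
      (hzw.symm.mono (by simp) (by simp))
  · exact hdisj.imp fun hzw => (commute_toMatrix
      (hzw.symm.mono (support_cnot_subset _) (support_cnot_subset _))).mul_left
      (commute_toMatrix (hzw.symm.mono (by simp) (support_cnot_subset _)))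
  · exact hdisj.imp fun hzw => commute_toMatrix
      (hzw.symm.mono (support_cnot_subset _) (by simp))

end QGate

/-- One step of a controlled layer: an `X` gate on each of the `wires` if the control bit is `1`,
the `gates` whatever the control bit, and the `phase` if the control bit is `1`. -/
structure Stage (Q : Type) : Type where
  wires : List Q
  gates : List (QGate Q)
  phase : Circle

namespace Stage

section

variable {Q : Type}

/-- The gates that the stage applies when the control bit is `b`. -/
def run (s : Stage Q) (b : Fin 2) : List (QGate Q) := s.wires.map (QGate.xPow b) ++ s.gates

/-- Stages on disjoint sets of qubits, performed simultaneously. -/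
def join (l : List (Stage Q)) : Stage Q :=
  ⟨l.flatMap wires, l.flatMap gates, (l.map phase).prod⟩

theorem run_join_perm (l : List (Stage Q)) (b : Fin 2) :
    ((join l).run b).Perm (l.flatMap fun s => s.run b) := by
  rw [run, join, List.map_flatMap]
  exact List.flatMap_append_perm _ _ _

end

/-- The stage is a layer of elementary gates on the qubits in `S`. -/
structure IsWithin (s : Stage Q) (S : Finset Q) : Prop where
  isCnotOrSingle : ∀ g ∈ s.gates, g.IsCnotOrSingle
  pairwise_disjoint : ∀ b, (s.run b).Pairwise fun f g => Disjoint f.support g.support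
  support_subset : ∀ b, ∀ g ∈ s.run b, g.support ⊆ S

variable {ι : Type*} {l : List ι} {s : ι → Stage Q} {S : ι → Finset Q}

theorem IsWithin.wires_nodup {s : Stage Q} {S : Finset Q} (h : s.IsWithin S) : s.wires.Nodup := by
  have hpair := (List.pairwise_append.1 (h.pairwise_disjoint 0)).1
  exact (List.pairwise_map.1 hpair).imp (by simp)

theorem IsWithin.mem_of_mem_wires {s : Stage Q} {S : Finset Q} (h : s.IsWithin S) {q : Q}
    (hq : q ∈ s.wires) : q ∈ S := by
  simpa using h.support_subset 0 (QGate.xPow 0 q)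
    (List.mem_append_left _ (List.mem_map_of_mem hq))

theorem isWithin_join {T : Finset Q} (hl : l.Pairwise fun i j => Disjoint (S i) (S j))
    (h : ∀ i ∈ l, (s i).IsWithin (S i)) (hT : ∀ i ∈ l, S i ⊆ T) :
    (join (l.map s)).IsWithin T where
  isCnotOrSingle g hg := by
    simp only [join, List.flatMap_map, List.mem_flatMap] at hg
    obtain ⟨i, hi, hg⟩ := hg
    exact (h i hi).isCnotOrSingle g hg
  pairwise_disjoint b := by
    refine ((run_join_perm _ b).pairwise_iff fun hfg => hfg.symm).2 ?_
    rw [List.flatMap_map, List.pairwise_flatMap]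
    refine ⟨fun i hi => (h i hi).pairwise_disjoint b, hl.imp_of_mem fun hi hj hij f hf g hg => ?_⟩
    exact hij.mono ((h _ hi).support_subset b f hf) ((h _ hj).support_subset b g hg)
  support_subset b g hg := by
    rw [(run_join_perm _ b).mem_iff, List.flatMap_map, List.mem_flatMap] at hg
    obtain ⟨i, hi, hg⟩ := hg
    exact ((h i hi).support_subset b g hg).trans (hT i hi)

variable [Fintype Q]

/-- The operator of the stage when the control bit is `b`. -/
def op (s : Stage Q) (b : Fin 2) : QOp Q :=
  ((s.phase ^ b.val : Circle) : ℂ) • gatesOp (s.run b)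

theorem IsWithin.op_mem_localAlgebra {s : Stage Q} {S : Finset Q} (h : s.IsWithin S) (b : Fin 2) :
    s.op b ∈ localAlgebra S :=
  Subalgebra.smul_mem _ (gatesOp_mem_localAlgebra (h.support_subset b)) _

theorem op_join (hl : l.Pairwise fun i j => Disjoint (S i) (S j))
    (h : ∀ i ∈ l, (s i).IsWithin (S i)) (b : Fin 2) :
    (join (l.map s)).op b = (l.map fun i => (s i).op b).prod := by
  have hcomm : (((join (l.map s)).run b).map QGate.toMatrix).Pairwise Commute :=
    List.pairwise_map.2 <| ((isWithin_join hl h (T := Finset.univ)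
      fun i _ => Finset.subset_univ _).pairwise_disjoint b).imp QGate.commute_toMatrix
  rw [op, gatesOp, ((run_join_perm _ b).map _).prod_eq' hcomm, ← gatesOp]
  clear hcomm hl h
  induction l with
  | nil => simp [join]
  | cons i l ih =>
    rw [List.map_cons, List.map_cons, List.prod_cons, ← ih]
    simp only [List.flatMap_cons, gatesOp_append, join, op, List.map_cons, List.prod_cons, mul_pow,
      Circle.coe_mul, smul_mul_smul_comm]

end Stage

theorem exists_map_fst_append_map_snd_append {α : Type*} {l : List α} {m : ℕ}
    (h : l.length ≤ 2 * m) : ∃ (zs : List (α × α)) (rest : List α),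
      zs.map Prod.fst ++ zs.map Prod.snd ++ rest = l ∧ zs.length + rest.length ≤ m := by
  set k := l.length / 2
  refine ⟨(l.take k).zip ((l.drop k).take k), l.drop (2 * k), ?_, ?_⟩
  · have hle : (l.take k).length = ((l.drop k).take k).length := by simp; omega
    rw [List.map_fst_zip hle.le, List.map_snd_zip hle.ge, List.append_assoc, two_mul,
      ← List.drop_drop, List.take_append_drop, List.take_append_drop]
  · simp; omega

namespace Stage

theorem IsWithin.of_sublist {s t : Stage Q} {S : Finset Q} (h : s.IsWithin S)
    (hwires : t.wires.Sublist s.wires) (hgates : t.gates.Sublist s.gates) : t.IsWithin S :=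
  have hrun b : (t.run b).Sublist (s.run b) := (hwires.map _).append hgates
  ⟨fun g hg => h.isCnotOrSingle g (hgates.subset hg),
    fun b => (h.pairwise_disjoint b).sublist (hrun b),
    fun b g hg => h.support_subset b g ((hrun b).subset hg)⟩

theorem IsWithin.length_wires_le_card {s : Stage Q} {S : Finset Q} (h : s.IsWithin S) :
    s.wires.length ≤ S.card := by
  rw [← List.toFinset_card_of_nodup h.wires_nodup]
  exact Finset.card_le_card fun q hq => h.mem_of_mem_wires (List.mem_toFinset.1 hq)

end Stage

variable [Fintype Q] {K : Finset Q}

theorem RealizesOn.conj {β : Type*} {v : β → QBasis Q} {k : ℕ} {M : β → QOp Q}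
    (h : RealizesOn K v k M) (L : QLayer Q) (hL : ∀ g ∈ L.gates, g.IsCnotOrSingle)
    (hK : ∀ g ∈ L.gates, g.support ⊆ Kᶜ) :
    RealizesOn K v (k + 2) fun b => gatesOp L.gates * M b * gatesOp L.gates := by
  have hlayer : RealizesOn K v 1 fun _ => gatesOp L.gates :=
    .of_layer L hL (fun _ => gatesOp_mem_localAlgebra hK) fun _ => rfl
  simpa only [mul_assoc, add_comm, add_left_comm, Nat.reduceAdd] using (hlayer.comp h).comp hlayer

theorem QGate.phaseUnitary_mul_patternProj {c : Q} (hc : c ∈ K) (z : Circle) (b : Fin 2) :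
    (one c (phaseUnitary z)).toMatrix * patternProj K (fun _ => b)
      = ((z ^ b.val : Circle) : ℂ) • patternProj K (fun _ => b) := by
  refine Matrix.mulVec_injective (funext fun ψ => funext fun x => ?_)
  rw [toMatrix_one, ← Matrix.mulVec_mulVec, QLens.op_phaseUnitary_mulVec, Matrix.smul_mulVec,
    Pi.smul_apply, patternProj_mulVec, smul_eq_mul]
  by_cases hx : ∀ q ∈ K, x q = b
  · have hxc : (QLens.qubit c).get x = b := hx c hc
    rw [hxc, if_pos hx]
    fin_cases b <;> simp
  · simp [hx]

namespace Stage

theorem op_of_phase_eq_one {s : Stage Q} (hs : s.phase = 1) (b : Fin 2) :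
    s.op b = gatesOp (s.wires.map (QGate.xPow b)) * gatesOp s.gates := by
  rw [op, run, hs, one_pow, Circle.coe_one, one_smul, gatesOp_append]

theorem realizesOn_of_map_snd_eq_wires {s : Stage Q} (h : s.IsWithin Kᶜ) (hs : s.phase = 1)
    {zs : List (Q × Q)} (hfst : (zs.map Prod.fst).Nodup) (hK : ∀ z ∈ zs, z.1 ∈ K)
    (hsnd : zs.map Prod.snd = s.wires) : RealizesOn K (fun b _ => b) 1 s.op := by
  have hmem : ∀ z ∈ zs, z.1 ∈ K ∧ z.2 ∉ K := fun z hz =>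
    ⟨hK z hz, Finset.mem_compl.1 (h.mem_of_mem_wires (hsnd ▸ List.mem_map_of_mem hz))⟩
  have hnodup : (zs.map Prod.fst ++ zs.map Prod.snd).Nodup := by
    refine List.nodup_append'.2 ⟨hfst, hsnd ▸ h.wires_nodup, fun q hq hq' => ?_⟩
    obtain ⟨z, hz, rfl⟩ := List.mem_map.1 hq
    obtain ⟨w, hw, hwz⟩ := List.mem_map.1 hq'
    exact (hmem w hw).2 (hwz ▸ hK z hz)
  obtain ⟨-, hgates, hdisj⟩ := List.pairwise_append.1 (h.pairwise_disjoint 0)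
  have hgatesK : ∀ g ∈ s.gates, g.support ⊆ Kᶜ := fun g hg =>
    h.support_subset 0 g (List.mem_append_right _ hg)
  have hlayer : (zs.map QGate.cnot ++ s.gates).Pairwise
      fun f g => Disjoint f.support g.support := by
    refine List.pairwise_append.2 ⟨QGate.pairwise_disjoint_support_cnot hnodup, hgates, ?_⟩
    refine List.forall_mem_map.2 fun z hz g hg => ?_
    refine Disjoint.mono_left (QGate.support_cnot_subset z) (Finset.disjoint_insert_left.2 ?_)
    exact ⟨fun hzg => Finset.mem_compl.1 (hgatesK g hg hzg) (hK z hz),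
      hdisj _ (List.mem_map_of_mem (hsnd ▸ List.mem_map_of_mem hz)) g hg⟩
  refine .of_layer ⟨_, hlayer⟩ (List.forall_mem_append.2 ⟨?_, h.isCnotOrSingle⟩)
    h.op_mem_localAlgebra fun b => ?_
  · exact List.forall_mem_map.2 fun z _ => QGate.isCnotOrSingle_cnot z
  · have hcomm := (commute_patternProj (fun _ => b) (gatesOp_mem_localAlgebra hgatesK)).eq
    rw [op_of_phase_eq_one hs, gatesOp_append, mul_assoc, hcomm, ← mul_assoc,
      QGate.gatesOp_map_cnot_mul_patternProj hmem, hsnd, mul_assoc, ← hcomm, mul_assoc]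

theorem realizesOn_of_length_le_card {s : Stage Q} (h : s.IsWithin Kᶜ) (hs : s.phase = 1)
    (hcard : s.wires.length ≤ K.card) : RealizesOn K (fun b _ => b) 1 s.op := by
  have hlen : (K.toList.take s.wires.length).length = s.wires.length := by simpa using hcard
  have hfst := List.map_fst_zip hlen.le
  have hnodup : (((K.toList.take s.wires.length).zip s.wires).map Prod.fst).Nodup := by
    rw [hfst]
    exact K.nodup_toList.sublist (List.take_sublist _ _)
  refine realizesOn_of_map_snd_eq_wires h hs hnodup (fun z hz => ?_) (List.map_snd_zip hlen.ge)
  exact Finset.mem_toList.1 (List.mem_of_mem_take (hfst ▸ List.mem_map_of_mem hz))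

theorem op_eq_conj_cnot {s : Stage Q} {S : Finset Q} (h : s.IsWithin S) (hs : s.phase = 1)
    {zs : List (Q × Q)} {rest : List Q}
    (hwires : zs.map Prod.fst ++ zs.map Prod.snd ++ rest = s.wires) (b : Fin 2) :
    s.op b = gatesOp (zs.map QGate.cnot) * op ⟨zs.map Prod.fst ++ rest, s.gates, 1⟩ b
      * gatesOp (zs.map QGate.cnot) := by
  have hrun : s.run b = (zs.map Prod.fst ++ zs.map Prod.snd).map (QGate.xPow b)
      ++ (rest.map (QGate.xPow b) ++ s.gates) := by
    rw [run, ← hwires, List.map_append, List.append_assoc]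
  have hdisj := (List.pairwise_append.1 (hrun ▸ h.pairwise_disjoint b)).2.2
  have hcomm : Commute (gatesOp (rest.map (QGate.xPow b) ++ s.gates))
      (gatesOp (zs.map QGate.cnot)) := by
    refine commute_gatesOp fun g hg => List.forall_mem_map.2 fun z hz => ?_
    refine Disjoint.mono_right (QGate.support_cnot_subset z) ?_
    simp only [Finset.disjoint_insert_right, Finset.disjoint_singleton_right]
    constructor <;> refine Finset.disjoint_singleton_left.1 (hdisj _ (List.mem_map_of_mem ?_) g hg)
    · exact List.mem_append_left _ (List.mem_map_of_mem hz)
    · exact List.mem_append_right _ (List.mem_map_of_mem hz)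
  rw [gatesOp_append] at hcomm
  have hnodup := (hwires ▸ h.wires_nodup).of_append_left
  simp only [op_of_phase_eq_one, hs, ← hwires, List.map_append, gatesOp_append]
  rw [← QGate.gatesOp_conj_cnot hnodup]
  simp only [mul_assoc, hcomm.eq]

theorem realizesOn_of_length_le_card_mul_two_pow {h : ℕ} {s : Stage Q} (hs : s.IsWithin Kᶜ)
    (hphase : s.phase = 1) (hcard : s.wires.length ≤ K.card * 2 ^ h) :
    RealizesOn K (fun b _ => b) (2 * h + 1) s.op := by
  induction h generalizing s with
  | zero => exact realizesOn_of_length_le_card hs hphase (by simpa using hcard)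
  | succ h ih =>
    obtain ⟨zs, rest, hwires, hlen⟩ := exists_map_fst_append_map_snd_append
      (hcard.trans_eq (show _ = 2 * (K.card * 2 ^ h) by ring))
    let t : Stage Q := ⟨zs.map Prod.fst ++ rest, s.gates, 1⟩
    have ht : t.IsWithin Kᶜ := hs.of_sublist
      (hwires ▸ (List.sublist_append_left _ _).append (.refl _)) (.refl _)
    let L : QLayer Q := ⟨zs.map QGate.cnot,
      QGate.pairwise_disjoint_support_cnot (hwires ▸ hs.wires_nodup).of_append_left⟩
    have hwiresK : ∀ q ∈ zs.map Prod.fst ++ zs.map Prod.snd ++ rest, q ∈ Kᶜ :=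
      hwires ▸ fun q hq => hs.mem_of_mem_wires hq
    have hLK : ∀ g ∈ L.gates, g.support ⊆ Kᶜ := List.forall_mem_map.2 fun z hz =>
      (QGate.support_cnot_subset z).trans <| Finset.insert_subset
        (hwiresK _ (by simp [List.mem_map_of_mem hz]))
        (Finset.singleton_subset_iff.2 (hwiresK _ (by simp [List.mem_map_of_mem hz])))
    rw [funext (op_eq_conj_cnot hs hphase hwires)]
    exact (ih ht rfl (by simpa [t] using hlen)).conj L
      (List.forall_mem_map.2 fun z _ => QGate.isCnotOrSingle_cnot z) hLK

theorem realizesOn_of_wires_eq_nil (hK : K.Nonempty) {s : Stage Q} (h : s.IsWithin Kᶜ)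
    (hs : s.wires = []) : RealizesOn K (fun b _ => b) 1 s.op := by
  obtain ⟨c, hc⟩ := hK
  have hrun : ∀ b, s.run b = s.gates := by simp [run, hs]
  have hsub : ∀ g ∈ s.gates, g.support ⊆ Kᶜ := hrun 0 ▸ h.support_subset 0
  have hdisj := h.pairwise_disjoint 0
  rw [hrun] at hdisj
  refine .of_layer ⟨.one c (phaseUnitary s.phase) :: s.gates, List.pairwise_cons.2 ⟨?_, hdisj⟩⟩
    (List.forall_mem_cons.2 ⟨trivial, h.isCnotOrSingle⟩) h.op_mem_localAlgebra fun b => ?_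
  · intro g hg
    simpa [QGate.support] using fun hcg => Finset.mem_compl.1 (hsub g hg hcg) hc
  · have hcomm := (commute_patternProj (fun _ => b) (gatesOp_mem_localAlgebra hsub)).eq
    rw [op, hrun, gatesOp_cons, mul_assoc, hcomm, ← mul_assoc,
      QGate.phaseUnitary_mul_patternProj hc, smul_mul_assoc, ← hcomm, smul_mul_assoc]

end Stage

theorem RealizesOn.list_prod {ι β : Type*} {v : β → QBasis Q} {l : List ι} {k : ι → ℕ}
    {M : ι → β → QOp Q} (h : ∀ i ∈ l, RealizesOn K v (k i) (M i)) :
    RealizesOn K v (l.map k).sum fun b => (l.map fun i => M i b).prod := by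
  induction l with
  | nil => exact .one
  | cons i l ih =>
    obtain ⟨hi, hl⟩ := List.forall_mem_cons.1 h
    simpa only [List.map_cons, List.sum_cons, List.prod_cons, add_comm (k i)] using (ih hl).comp hi

namespace Stage

/-- The stages of a recipe that may apply `X` gates depending on the control bit. -/
def fanOutStages : Finset (Fin 9) := {1, 4, 5, 6}

/-- The stages `r`, of which `r 0` is performed last, apply the gate `g` if the control bit is `1`
and do nothing if it is `0`. -/
structure IsRecipe (r : Fin 9 → Stage Q) (g : QGate Q) : Prop where
  isWithin : ∀ i, (r i).IsWithin g.support
  wires_eq_nil : ∀ i, i ∉ fanOutStages → (r i).wires = []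
  phase_eq_one : ∀ i, i ∈ fanOutStages → (r i).phase = 1
  prod_op : ∀ b, ((List.finRange 9).map fun i => (r i).op b).prod = if b = 0 then 1 else g.toMatrix

theorem exists_isRecipe_one (q : Q) (U : Matrix.unitaryGroup (Fin 2) ℂ) :
    ∃ r, IsRecipe r (.one q U) := by
  obtain ⟨A, B, C, z, hABC, hU⟩ := exists_abc U
  refine ⟨![⟨[], [.one q A], z⟩, ⟨[q], [], 1⟩, ⟨[], [.one q B], 1⟩, ⟨[], [], 1⟩, ⟨[], [], 1⟩,
    ⟨[q], [], 1⟩, ⟨[], [], 1⟩, ⟨[], [], 1⟩, ⟨[], [.one q C], 1⟩], fun i => ?_, ?_, ?_, fun b => ?_⟩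
  · fin_cases i <;> constructor <;>
      simp [run, QGate.xPow, QGate.support, QGate.IsCnotOrSingle]
  · simp [Fin.forall_fin_succ, fanOutStages]
  · simp [fanOutStages]
  · have hbit : ((z ^ b.val : Circle) : ℂ) • (A * pauliX ^ b.val * B * pauliX ^ b.val * C).1
        = if b = 0 then 1 else U.1 := by
      fin_cases b
      · simp [hABC]
      · simpa using hU
    have hlens : (if b = 0 then 1 else (QGate.one q U).toMatrix)
        = (QLens.qubit q).op (if b = 0 then 1 else U.1) := by
      split_ifs <;> simp [QGate.toMatrix_one]
    rw [hlens, ← hbit]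
    simp [List.finRange_succ, op, run, QGate.xPow, QGate.toMatrix_one, map_smul, map_mul, mul_assoc]

theorem exists_isRecipe_cnot {p q : Q} (h : p ≠ q) :
    ∃ r, IsRecipe r (.two p q h cnotUnitary) := by
  refine ⟨![⟨[], [.one q hadamardUnitary], eighthRoot⟩, ⟨[p], [], 1⟩,
    ⟨[], [.one p (phaseUnitary eighthRoot⁻¹)], 1⟩, ⟨[], [.two q p h.symm cnotUnitary], 1⟩,
    ⟨[q], [.one p (phaseUnitary eighthRoot)], 1⟩, ⟨[p], [.one q (phaseUnitary eighthRoot⁻¹)], 1⟩,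
    ⟨[q], [.one p (phaseUnitary eighthRoot⁻¹)], 1⟩, ⟨[], [.two q p h.symm cnotUnitary], 1⟩,
    ⟨[], [.one q (phaseUnitary eighthRoot * hadamardUnitary), .one p (phaseUnitary eighthRoot)],
      1⟩], fun i => ?_, ?_, ?_, fun b => ?_⟩
  · fin_cases i <;> constructor <;>
      simp [run, QGate.xPow, QGate.support, QGate.IsCnotOrSingle, cnotUnitary, h,
        h.symm, Finset.pair_comm]
  · simp [Fin.forall_fin_succ, fanOutStages]
  · simp [fanOutStages]
  · have hlens : (if b = 0 then 1 else (QGate.two p q h cnotUnitary).toMatrix)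
        = (QLens.pair h).op (if b = 0 then 1 else cnotUnitary.1) := by
      split_ifs <;> simp [QGate.toMatrix_two]
    rw [hlens, ← QLens.cnot_template]
    simp only [map_smul, map_mul, ← QLens.op_comp, QLens.pair_comp_first, QLens.pair_comp_second,
      QLens.pair_comp_exchange]
    simp [List.finRange_succ, op, run, QGate.xPow, QGate.toMatrix_one, QGate.toMatrix_two,
      mul_assoc]

theorem exists_isRecipe {g : QGate Q} (hg : g.IsCnotOrSingle) : ∃ r, IsRecipe r g := by
  cases g with
  | one q U => exact exists_isRecipe_one q U
  | two p q h U =>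
    obtain rfl : U = cnotUnitary := Subtype.ext hg
    exact exists_isRecipe_cnot h

end Stage

theorem RealizesOn.controlled_layer (hK : K.Nonempty) {h : ℕ}
    (hcard : Fintype.card Q ≤ K.card + K.card * 2 ^ h) {L : QLayer Q}
    (hL : ∀ g ∈ L.gates, g.IsCnotOrSingle) (hLK : ∀ g ∈ L.gates, g.support ⊆ Kᶜ) :
    RealizesOn K (fun b _ => b) (8 * h + 9) fun b : Fin 2 => if b = 0 then 1 else L.toMatrix := by
  have : Nonempty (Stage Q) := ⟨⟨[], [], 1⟩⟩
  choose! r hr using fun (g : QGate Q) (hg : g.IsCnotOrSingle) => Stage.exists_isRecipe hg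
  replace hr : ∀ g ∈ L.gates, Stage.IsRecipe (r g) g := fun g hg => hr g (hL g hg)
  let s (i : Fin 9) : Stage Q := .join (L.gates.map (r · i))
  have hwithin (i : Fin 9) : ∀ g ∈ L.gates, (r g i).IsWithin g.support :=
    fun g hg => (hr g hg).isWithin i
  have hs (i : Fin 9) : (s i).IsWithin Kᶜ := Stage.isWithin_join L.disjoint (hwithin i) hLK
  have hstage : ∀ i ∈ List.finRange 9, RealizesOn K (fun b _ => b)
      (if i ∈ Stage.fanOutStages then 2 * h + 1 else 1) (s i).op := by
    intro i _
    split_ifs with hi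
    · refine Stage.realizesOn_of_length_le_card_mul_two_pow (hs i) ?_ ?_
      · exact List.prod_eq_one
          (by simpa [s, Stage.join] using fun g hg => (hr g hg).phase_eq_one i hi)
      · have hle := (hs i).length_wires_le_card
        rw [Finset.card_compl] at hle
        omega
    · refine Stage.realizesOn_of_wires_eq_nil hK (hs i) ?_
      simpa [s, Stage.join] using fun g hg => (hr g hg).wires_eq_nil i hi
  have hdepth : ((List.finRange 9).map fun i =>
      if i ∈ Stage.fanOutStages then 2 * h + 1 else 1).sum = 8 * h + 9 := by
    simp [List.finRange_succ, Stage.fanOutStages]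
    ring
  convert RealizesOn.list_prod hstage using 1
  · exact hdepth.symm
  · funext b
    simp only [s, Stage.op_join L.disjoint (hwithin _)]
    rw [prod_map_prod_map_comm, List.map_congr_left fun g hg => (hr g hg).prod_op b]
    · split_ifs <;> simp [QLayer.toMatrix]
    · refine L.disjoint.imp_of_mem fun hf hg hfg i j => ?_
      exact commute_of_mem_localAlgebra hfg.symm ((hwithin i _ hg).op_mem_localAlgebra b)
        ((hwithin j _ hf).op_mem_localAlgebra b)

theorem RealizesOn.controlled_circuit (hK : K.Nonempty) {h : ℕ}
    (hcard : Fintype.card Q ≤ K.card + K.card * 2 ^ h) {C : QCircuit Q} (hC : C.UsesCnotAndSingle)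
    (hCK : ∀ L ∈ C, ∀ g ∈ L.gates, g.support ⊆ Kᶜ) :
    RealizesOn K (fun b _ => b) (C.depth * (8 * h + 9))
      fun b : Fin 2 => if b = 0 then 1 else C.toMatrix := by
  induction C with
  | nil => simpa [QCircuit.depth, QCircuit.toMatrix] using RealizesOn.one
  | cons L C ih =>
    obtain ⟨hL, hC⟩ := List.forall_mem_cons.1 hC
    obtain ⟨hLK, hCK⟩ := List.forall_mem_cons.1 hCK
    convert (RealizesOn.controlled_layer hK hcard hL hLK).comp (ih hC hCK) using 1
    · simp only [QCircuit.depth, List.length_cons]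
      ring
    · funext b
      split_ifs <;> simp [QCircuit.toMatrix]

end ControlledLayers

noncomputable section FanOut

variable {Q : Type} [DecidableEq Q] [Fintype Q] {K : Finset Q}

namespace QGate

theorem cnot_mul_patternProj_of_mem {z : Q × Q} (h : z.1 ≠ z.2) (h₁ : z.1 ∈ K) (h₂ : z.2 ∈ K)
    (v : QBasis Q) :
    (cnot z).toMatrix * patternProj K v
      = patternProj K (Function.update v z.2 (v z.2 + v z.1)) * (cnot z).toMatrix := by
  refine Matrix.mulVec_injective (funext fun ψ => funext fun x => ?_)
  simp only [← Matrix.mulVec_mulVec, patternProj_mulVec, cnot_mulVec h]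
  refine if_congr ?_ rfl rfl
  have add_eq_iff : ∀ a c e : Fin 2, a + c = e ↔ a = e + c := by decide
  have hbit : x z.1 = v z.1 → (x z.2 + x z.1 = v z.2 ↔ x z.2 = v z.2 + v z.1) := fun hx => by
    rw [hx, add_eq_iff]
  constructor <;> intro hx q hq <;> have h1 := hx _ h₁ <;> have hq' := hx q hq <;>
    rw [Function.update_of_ne h] at h1 <;> obtain rfl | hne := eq_or_ne q z.2 <;>
    simp_all

theorem gatesOp_map_cnot_mul_patternProj_of_mem {zs : List (Q × Q)}
    (h : (zs.map Prod.fst ++ zs.map Prod.snd).Nodup) (hK : ∀ z ∈ zs, z.1 ∈ K ∧ z.2 ∈ K)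
    {v w : QBasis Q} (hw : ∀ z ∈ zs, w z.2 = v z.2 + v z.1)
    (hwv : ∀ q ∈ K, q ∉ zs.map Prod.snd → w q = v q) :
    gatesOp (zs.map cnot) * patternProj K v = patternProj K w * gatesOp (zs.map cnot) := by
  induction zs generalizing w with
  | nil => simp [patternProj_congr fun q hq => hwv q hq (by simp)]
  | cons z zs ih =>
    obtain ⟨hfst, hsnd, hdisj⟩ := List.nodup_append'.1 h
    rw [List.map_cons, List.nodup_cons] at hfst hsnd
    have hz₁ : z.1 ∉ zs.map Prod.snd := fun hz =>
      hdisj List.mem_cons_self (List.mem_cons_of_mem _ hz)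
    have hz : z.1 ≠ z.2 := fun heq => hdisj List.mem_cons_self (heq ▸ List.mem_cons_self)
    have hnodup : (zs.map Prod.fst ++ zs.map Prod.snd).Nodup :=
      List.nodup_append'.2 ⟨hfst.2, hsnd.2, fun q hq hq' =>
        hdisj (List.mem_cons_of_mem _ hq) (List.mem_cons_of_mem _ hq')⟩
    obtain ⟨hzK, hK⟩ := List.forall_mem_cons.1 hK
    obtain ⟨hwz, hw⟩ := List.forall_mem_cons.1 hw
    have hwz₁ : w z.1 = v z.1 := hwv _ hzK.1 (by simp [hz, hz₁])
    rw [List.map_cons, gatesOp_cons, mul_assoc,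
      ih hnodup hK (w := Function.update w z.2 (v z.2)) (fun y hy => ?_) (fun q hq hqzs => ?_),
      ← mul_assoc, cnot_mul_patternProj_of_mem hz hzK.1 hzK.2, mul_assoc,
      Function.update_self, Function.update_of_ne hz, Function.update_idem, hwz₁, ← hwz,
      Function.update_eq_self]
    · rw [Function.update_of_ne, hw y hy]
      exact fun heq => hsnd.1 (heq ▸ List.mem_map_of_mem hy)
    · obtain rfl | hne := eq_or_ne q z.2
      · simp
      · rw [Function.update_of_ne hne, hwv q hq (by simp [hne, hqzs])]

theorem gatesOp_map_cnot_mul_self {zs : List (Q × Q)}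
    (h : (zs.map Prod.fst ++ zs.map Prod.snd).Nodup) :
    gatesOp (zs.map cnot) * gatesOp (zs.map cnot) = 1 := by
  have hcomm : zs.Pairwise fun z w => Commute (cnot w).toMatrix (cnot z).toMatrix :=
    (pairwise_disjoint_pair h).imp fun hzw => commute_toMatrix
      (hzw.symm.mono (support_cnot_subset _) (support_cnot_subset _))
  simp only [gatesOp, List.map_map, Function.comp_def]
  rw [prod_map_mul_prod_map hcomm]
  simp [cnot_mul_cnot]

end QGate

theorem RealizesOn.congr_pattern {β : Type*} {v w : β → QBasis Q} {k : ℕ} {M : β → QOp Q}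
    (h : RealizesOn K w k M) (hvw : ∀ b, ∀ q ∈ K, v b q = w b q) : RealizesOn K v k M := by
  simpa only [RealizesOn, patternProj_congr (hvw _)] using h

theorem RealizesOn.conj_pattern {β : Type*} {v w : β → QBasis Q} {k : ℕ} {M : β → QOp Q}
    (h : RealizesOn K w k M) (L : QLayer Q) (hL : ∀ g ∈ L.gates, g.IsCnotOrSingle)
    (hK : ∀ g ∈ L.gates, g.support ⊆ K) (hinv : gatesOp L.gates * gatesOp L.gates = 1)
    (hvw : ∀ b, gatesOp L.gates * patternProj K (v b) = patternProj K (w b) * gatesOp L.gates) :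
    RealizesOn K v (k + 2) M := by
  obtain ⟨hM, D, hD, hk, hDM⟩ := h
  have hLcirc : QCircuit.UsesCnotAndSingle [L] := by simpa [QCircuit.UsesCnotAndSingle] using hL
  refine ⟨hM, [L] ++ (D ++ [L]), hLcirc.append (hD.append hLcirc), ?_, fun b => ?_⟩
  · simp only [QCircuit.depth, List.length_append, List.length_singleton] at hk ⊢
    omega
  · have hcomm : Commute (gatesOp L.gates) (M b) :=
      commute_of_mem_localAlgebra disjoint_compl_right (gatesOp_mem_localAlgebra hK) (hM b)
    rw [QCircuit.toMatrix_append, QCircuit.toMatrix_append, QCircuit.toMatrix_singleton, mul_assoc,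
      hvw, mul_assoc, ← mul_assoc D.toMatrix, hDM, mul_assoc, ← hvw, ← mul_assoc, hcomm.eq,
      mul_assoc, ← mul_assoc (gatesOp _), hinv, one_mul]

/-- The basis state with the bit `b` on the first `m` qubits of `ks` and `0` on all others. -/
def prefixPattern (ks : List Q) (m : ℕ) (b : Fin 2) : QBasis Q :=
  fun q => if q ∈ ks.take m then b else 0

theorem RealizesOn.of_prefixPattern_two_mul {ks : List Q} (hks : ks.Nodup) {m k : ℕ}
    {M : Fin 2 → QOp Q} (h : RealizesOn ks.toFinset (prefixPattern ks (2 * m)) k M) :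
    RealizesOn ks.toFinset (prefixPattern ks m) (k + 2) M := by
  set copies := (ks.drop m).take m with hcopies
  have hle : copies.length ≤ m := List.length_take_le _ _
  have hlen : (ks.take copies.length).length = copies.length := by
    simp [hcopies]
  set zs := (ks.take copies.length).zip copies
  have hfst : zs.map Prod.fst = ks.take copies.length := List.map_fst_zip hlen.le
  have hsnd : zs.map Prod.snd = copies := List.map_snd_zip hlen.ge
  have hsub : (zs.map Prod.fst ++ zs.map Prod.snd).Sublist ks := by
    rw [hfst, hsnd]
    conv_rhs => rw [← List.take_append_drop m ks]
    exact (List.take_sublist_take_left hle).append (List.take_sublist _ _)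
  have hnodup := hks.sublist hsub
  have hdouble : ∀ q, q ∈ ks.take (2 * m) ↔ q ∈ ks.take m ∨ q ∈ copies := fun q => by
    rw [two_mul, List.take_add, List.mem_append]
  have hK : ∀ z ∈ zs, z.1 ∈ ks.toFinset ∧ z.2 ∈ ks.toFinset := fun z hz => by
    constructor <;> refine List.mem_toFinset.2 (hsub.subset ?_) <;> simp [List.mem_map_of_mem hz]
  refine h.conj_pattern ⟨zs.map QGate.cnot, QGate.pairwise_disjoint_support_cnot hnodup⟩
    (List.forall_mem_map.2 fun z _ => QGate.isCnotOrSingle_cnot z)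
    (List.forall_mem_map.2 fun z hz => (QGate.support_cnot_subset z).trans <|
      Finset.insert_subset (hK z hz).1 (Finset.singleton_subset_iff.2 (hK z hz).2))
    (QGate.gatesOp_map_cnot_mul_self hnodup) fun b =>
      QGate.gatesOp_map_cnot_mul_patternProj_of_mem hnodup hK (fun z hz => ?_) fun q _ hqzs => ?_
  · have hz₁ : z.1 ∈ ks.take m :=
      List.take_subset_take_left _ hle (hfst ▸ List.mem_map_of_mem hz)
    have hz₂ : z.2 ∈ copies := hsnd ▸ List.mem_map_of_mem hz
    have hz₂' : z.2 ∉ ks.take m := fun hz₂' =>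
      List.disjoint_take_drop hks le_rfl hz₂' (List.mem_of_mem_take hz₂)
    simp only [prefixPattern, hdouble, hz₁, hz₂, hz₂', or_true, if_true, if_false, zero_add]
  · rw [hsnd] at hqzs
    simp only [prefixPattern, hdouble, hqzs, or_false]

theorem RealizesOn.of_prefixPattern_two_pow {ks : List Q} (hks : ks.Nodup) {c k : ℕ}
    {M : Fin 2 → QOp Q} (h : RealizesOn ks.toFinset (prefixPattern ks (2 ^ c)) k M) :
    RealizesOn ks.toFinset (prefixPattern ks 1) (k + 2 * c) M := by
  induction c generalizing k with
  | zero => exact h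
  | succ c ih =>
    rw [pow_succ'] at h
    rw [mul_add_one, add_comm (2 * c), ← add_assoc]
    exact ih (h.of_prefixPattern_two_mul hks)

theorem RealizesOn.of_const_pattern {ks : List Q} (hks : ks.Nodup) {c k : ℕ}
    (hc : ks.length ≤ 2 ^ c) {M : Fin 2 → QOp Q}
    (h : RealizesOn ks.toFinset (fun b _ => b) k M) :
    RealizesOn ks.toFinset (prefixPattern ks 1) (k + 2 * c) M := by
  refine .of_prefixPattern_two_pow hks (h.congr_pattern fun b q hq => ?_)
  rw [prefixPattern, List.take_of_length_le hc, if_pos (List.mem_toFinset.1 hq)]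

end FanOut

noncomputable section ControlledCircuits

theorem extend_eq_iff {P Q α : Type*} {δ : P → Q} (h : Function.Injective δ) {u : P → α}
    {x y : Q → α} :
    Function.extend δ u x = y ↔ (∀ p, u p = y (δ p)) ∧ ∀ q ∉ Set.range δ, x q = y q := by
  constructor
  · rintro rfl
    exact ⟨fun p => (h.extend_apply u x p).symm, fun q hq => (Function.extend_apply' u x q hq).symm⟩
  · rintro ⟨hu, hx⟩
    funext q
    by_cases hq : q ∈ Set.range δ
    · obtain ⟨p, rfl⟩ := hq
      rw [h.extend_apply, hu]
    · rw [Function.extend_apply' _ _ _ hq, hx q hq]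

namespace QLens

variable {P Q R : Type*} {δ : P → Q}

theorem subregister_comp_qubit [DecidableEq P] [DecidableEq Q] (h : Function.Injective δ) (p : P) :
    (subregister h).comp (qubit p) = qubit (δ p) := by
  refine QLens.ext rfl (funext fun b => funext fun x => (extend_eq_iff h).2 ⟨fun r => ?_, ?_⟩)
  · simp [subregister, qubit, Function.update_apply, h.eq_iff]
  · rintro q hq
    exact (Function.update_of_ne (fun he => hq ⟨p, he.symm⟩) _ _).symm

theorem subregister_comp_pair [DecidableEq P] [DecidableEq Q] (h : Function.Injective δ) {p p' : P}
    (hp : p ≠ p') : (subregister h).comp (pair hp) = pair (h.ne hp) := by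
  refine QLens.ext rfl (funext fun b => funext fun x => (extend_eq_iff h).2 ⟨fun r => ?_, ?_⟩)
  · simp [subregister, pair, Function.update_apply, h.eq_iff]
  · rintro q hq
    have hne : ∀ r, q ≠ δ r := fun r he => hq ⟨r, he.symm⟩
    simp [pair, Function.update_of_ne (hne _)]

theorem subregister_comp_subregister {ε : R → P} (h : Function.Injective δ)
    (hε : Function.Injective ε) :
    (subregister h).comp (subregister hε) = subregister (h.comp hε) := by
  refine QLens.ext rfl (funext fun u => funext fun x => (extend_eq_iff h).2 ⟨?_, ?_⟩)
  · intro p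
    change Function.extend ε u (x ∘ δ) p = (Function.extend (δ ∘ ε) u x ∘ δ) p
    refine congrFun ((extend_eq_iff hε).2 ⟨fun r => ?_, fun p hp => ?_⟩) p
    · exact ((h.comp hε).extend_apply u x r).symm
    · refine (Function.extend_apply' _ _ _ fun ⟨r, hr⟩ => hp ⟨r, h hr⟩).symm
  · rintro q hq
    exact (Function.extend_apply' _ _ _ fun ⟨r, hr⟩ => hq ⟨ε r, hr⟩).symm

end QLens

section map

variable {P Q : Type} {δ : P → Q}

/-- The gate moved along an injection of registers. -/
def QGate.map (hδ : Function.Injective δ) : QGate P → QGate Q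
  | one p U => one (δ p) U
  | two p q hpq U => two (δ p) (δ q) (hδ.ne hpq) U

variable (hδ : Function.Injective δ)

theorem QGate.IsCnotOrSingle.map {g : QGate P} (h : g.IsCnotOrSingle) :
    (g.map hδ).IsCnotOrSingle := by
  cases g <;> exact h

variable [DecidableEq P] [DecidableEq Q]

theorem QGate.support_map (g : QGate P) : (g.map hδ).support = g.support.map ⟨δ, hδ⟩ := by
  cases g <;> simp [map, support]

/-- The layer moved along an injection of registers. -/
def QLayer.map [Fintype P] [Fintype Q] (L : QLayer P) : QLayer Q where
  gates := L.gates.map (QGate.map hδ)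
  disjoint := List.pairwise_map.2 <| L.disjoint.imp fun h => by
    simpa only [QGate.support_map, Finset.disjoint_map] using h

variable [Fintype P] [Fintype Q]

theorem QCircuit.forall_mem_gates_map {C : QCircuit P} {p : QGate Q → Prop} :
    (∀ L ∈ List.map (QLayer.map hδ) C, ∀ g ∈ L.gates, p g) ↔
      ∀ L ∈ C, ∀ g ∈ L.gates, p (g.map hδ) := by
  simp [QLayer.map]

theorem QGate.toMatrix_map (g : QGate P) :
    (g.map hδ).toMatrix = (QLens.subregister hδ).op g.toMatrix := by
  cases g with
  | one p U =>
    rw [map, toMatrix_one, toMatrix_one, ← QLens.op_comp, QLens.subregister_comp_qubit]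
  | two p q hpq U =>
    rw [map, toMatrix_two, toMatrix_two, ← QLens.op_comp, QLens.subregister_comp_pair]

theorem QCircuit.toMatrix_map (C : QCircuit P) :
    QCircuit.toMatrix (List.map (QLayer.map hδ) C) = (QLens.subregister hδ).op C.toMatrix := by
  induction C with
  | nil => simp [toMatrix]
  | cons L C ih =>
    simp only [List.map_cons, toMatrix, ih, map_mul]
    simp only [QLayer.toMatrix, QLayer.map, map_list_prod, List.map_map, Function.comp_def,
      QGate.toMatrix_map]

end map

section Ancillas

variable {a n : ℕ}

theorem addZeroAncillas_sum {ι : Type*} (s : Finset ι) (ψ : ι → QState (CtrlReg n)) :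
    addZeroAncillas a (∑ i ∈ s, ψ i) = ∑ i ∈ s, addZeroAncillas a (ψ i) := by
  funext x
  simp [addZeroAncillas, Finset.sum_ite_irrel]

theorem injective_map_id_inr :
    Function.Injective (Sum.map id Sum.inr : CtrlReg n → AncReg a n) :=
  Sum.map_injective.2 ⟨Function.injective_id, Sum.inr_injective⟩

theorem op_mulVec_addZeroAncillas (M : QOp (CtrlReg n)) (ψ : QState (CtrlReg n)) :
    ((QLens.subregister injective_map_id_inr).op M).mulVec (addZeroAncillas a ψ)
      = addZeroAncillas a (M.mulVec ψ) := by
  funext x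
  have hanc : ∀ u i, Function.extend (Sum.map id Sum.inr) u x (Sum.inr (Sum.inl i))
      = x (Sum.inr (Sum.inl i)) := fun u i => Function.extend_apply' _ _ _ (by simp)
  have hext : ∀ u, Function.extend (Sum.map id Sum.inr) u x ∘ Sum.map id Sum.inr = u := fun u =>
    Function.extend_comp injective_map_id_inr u x
  rw [QLens.op_mulVec]
  simp only [QLens.subregister, addZeroAncillas, hanc, hext]
  split_ifs <;> simp [Matrix.mulVec, dotProduct]

theorem sum_patternProj_singleton {Q : Type} [Fintype Q] [DecidableEq Q] (q : Q) :
    ∑ b : Fin 2, patternProj {q} (fun _ => b) = 1 := by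
  ext x y
  simp [patternProj, Matrix.sum_apply, Matrix.diagonal_apply, Matrix.one_apply,
    Finset.sum_ite_irrel]

theorem controlled_apply (U : QOp (Fin n)) (x y : QBasis (CtrlReg n)) :
    controlled U x y = (QLens.subregister Sum.inr_injective).op
      (if y (Sum.inl ()) = 0 then 1 else U) x y := by
  rw [QLens.op_apply]
  refine if_congr ?_ rfl rfl
  simp [QLens.subregister, extend_eq_iff Sum.inr_injective, Unique.forall_iff]

theorem controlled_mul_patternProj (U : QOp (Fin n)) (b : Fin 2) :
    controlled U * patternProj {Sum.inl ()} (fun _ => b) =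
      (QLens.subregister Sum.inr_injective).op (if b = 0 then 1 else U)
        * patternProj {Sum.inl ()} (fun _ => b) := by
  ext x y
  simp only [patternProj, Matrix.mul_diagonal, Finset.mem_singleton, forall_eq, controlled_apply]
  split_ifs <;> simp_all

theorem onControl_eq_op (V : Matrix (Fin 2) (Fin 2) ℂ) :
    onControl V = (QLens.qubit (Sum.inl () : CtrlReg n)).op V := by
  ext x y
  rw [QLens.op_apply]
  refine if_congr ?_ rfl rfl
  simp [QLens.qubit, funext_iff]

/-- The control qubit followed by the ancillas. -/
def controlAncillas (a n : ℕ) : List (AncReg a n) :=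
  Sum.inl () :: (List.finRange a).map (Sum.inr ∘ Sum.inl)

theorem nodup_controlAncillas : (controlAncillas a n).Nodup := by
  refine List.nodup_cons.2 ⟨by simp, (List.nodup_finRange a).map ?_⟩
  exact Sum.inr_injective.comp Sum.inl_injective

theorem length_controlAncillas : (controlAncillas a n).length = a + 1 := by
  simp [controlAncillas]

theorem patternProj_mulVec_addZeroAncillas (b : Fin 2) (ψ : QState (CtrlReg n)) :
    (patternProj (controlAncillas a n).toFinset (prefixPattern (controlAncillas a n) 1 b)).mulVec
        (addZeroAncillas a ψ)
      = addZeroAncillas a ((patternProj {Sum.inl ()} fun _ => b).mulVec ψ) := by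
  funext x
  simp only [addZeroAncillas, patternProj_mulVec, ← ite_and]
  refine if_congr ?_ rfl rfl
  simp [controlAncillas, prefixPattern, and_comm]

theorem implements_controlled {D : QCircuit (AncReg a n)} {U : QOp (Fin n)}
    (hD : ∀ b : Fin 2, D.toMatrix * patternProj (controlAncillas a n).toFinset
        (prefixPattern (controlAncillas a n) 1 b) =
      (QLens.subregister (Sum.inr_injective.comp Sum.inr_injective)).op (if b = 0 then 1 else U) *
        patternProj (controlAncillas a n).toFinset (prefixPattern (controlAncillas a n) 1 b)) :
    Implements D (controlled U) := by
  have hop : ∀ M : QOp (Fin n),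
      (QLens.subregister (Sum.inr_injective.comp Sum.inr_injective)).op M =
        (QLens.subregister (injective_map_id_inr (a := a))).op
          ((QLens.subregister Sum.inr_injective).op M) := fun M => by
    rw [← QLens.op_comp, QLens.subregister_comp_subregister]
    rfl
  have hbranch : ∀ b ψ, D.toMatrix.mulVec
        (addZeroAncillas a ((patternProj {Sum.inl ()} fun _ => b).mulVec ψ)) =
      addZeroAncillas a ((controlled U).mulVec
        ((patternProj {Sum.inl ()} fun _ => b).mulVec ψ)) := fun b ψ => by
    rw [← patternProj_mulVec_addZeroAncillas, Matrix.mulVec_mulVec, hD, ← Matrix.mulVec_mulVec,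
      patternProj_mulVec_addZeroAncillas, hop, op_mulVec_addZeroAncillas, Matrix.mulVec_mulVec,
      Matrix.mulVec_mulVec, controlled_mul_patternProj]
  intro ψ
  have hψ : ψ = ∑ b : Fin 2, (patternProj {Sum.inl ()} fun _ => b).mulVec ψ := by
    rw [← Matrix.sum_mulVec, sum_patternProj_singleton, Matrix.one_mulVec]
  rw [hψ, addZeroAncillas_sum, Matrix.mulVec_sum, Matrix.mulVec_sum, addZeroAncillas_sum]
  exact Finset.sum_congr rfl fun b _ => hbranch b ψ

end Ancillas

theorem le_two_pow_ceil_logb {x : ℝ} (hx : 0 < x) : x ≤ 2 ^ ⌈Real.logb 2 x⌉₊ := by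
  rw [← Real.rpow_natCast, ← Real.logb_le_iff_le_rpow (by norm_num) hx]
  exact Nat.le_ceil _

theorem le_mul_two_pow_ceil_logb_div {m s : ℕ} (hs : 0 < s) :
    m ≤ s * 2 ^ ⌈Real.logb 2 ((m : ℝ) / s)⌉₊ := by
  obtain rfl | hm := m.eq_zero_or_pos
  · exact Nat.zero_le _
  have hs' : (0 : ℝ) < s := Nat.cast_pos.2 hs
  have h := (div_le_iff₀' hs').1 (le_two_pow_ceil_logb (div_pos (Nat.cast_pos.2 hm) hs'))
  exact_mod_cast h

theorem exists_implements_controlled {n s : ℕ} (hs : 1 ≤ s) {C : QCircuit (Fin n)}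
    (hC : C.UsesCnotAndSingle) :
    ∃ D : QCircuit (AncReg (s - 1) n), D.UsesCnotAndSingle ∧
      D.depth ≤ controlDepth n s C.depth ∧ Implements D (controlled C.toMatrix) := by
  set ks := controlAncillas (s - 1) n
  set C' : QCircuit (AncReg (s - 1) n) :=
    List.map (QLayer.map (Sum.inr_injective.comp Sum.inr_injective)) C
  have hks : ks.length = s := by rw [length_controlAncillas]; omega
  have hK : ks.toFinset.card = s := by rw [List.toFinset_card_of_nodup nodup_controlAncillas, hks]
  have hcard : Fintype.card (AncReg (s - 1) n) ≤ ks.toFinset.card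
      + ks.toFinset.card * 2 ^ ⌈Real.logb 2 ((n : ℝ) / s)⌉₊ := by
    rw [hK, card_ancReg s n hs, add_comm]
    exact Nat.add_le_add_left (le_mul_two_pow_ceil_logb_div hs) s
  have hlen : ks.length ≤ 2 ^ ⌈Real.logb 2 (s : ℝ)⌉₊ := by
    simpa [hks] using le_mul_two_pow_ceil_logb_div (m := s) one_pos
  have hC' : C'.UsesCnotAndSingle :=
    (QCircuit.forall_mem_gates_map _).2 fun L hL g hg => (hC L hL g hg).map _
  have hCK : ∀ L ∈ C', ∀ g ∈ L.gates, g.support ⊆ ks.toFinsetᶜ := by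
    refine (QCircuit.forall_mem_gates_map _).2 fun L _ g _ q hq => ?_
    rw [QGate.support_map] at hq
    obtain ⟨i, -, rfl⟩ := Finset.mem_map.1 hq
    simp [ks, controlAncillas]
  obtain ⟨-, D, hD, hdepth, hDM⟩ := RealizesOn.of_const_pattern nodup_controlAncillas hlen
    (RealizesOn.controlled_circuit (Finset.card_pos.1 (by omega)) hcard hC' hCK)
  refine ⟨D, hD, hdepth.trans ?_, implements_controlled fun b => (hDM b).trans ?_⟩
  · have hdepthC' : C'.depth = C.depth := List.length_map _
    rw [hdepthC', controlDepth]
    nlinarith [Nat.zero_le (C.depth * ⌈Real.logb 2 ((n : ℝ) / s)⌉₊)]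
  · rw [QCircuit.toMatrix_map, apply_ite (QLens.op _), map_one]

end ControlledCircuits

noncomputable section HadamardTest

variable {a n : ℕ} {M N : QOp (CtrlReg n)} {C D : QCircuit (AncReg a n)} {U : QOp (Fin n)}

theorem Implements.append (hC : Implements C M) (hD : Implements D N) :
    Implements (C ++ D) (N * M) := fun ψ => by
  rw [QCircuit.toMatrix_append, ← Matrix.mulVec_mulVec, hC, hD, Matrix.mulVec_mulVec]

/-- The layer with the single gate `V` on the control qubit. -/
def controlQubitLayer (a n : ℕ) (V : Matrix.unitaryGroup (Fin 2) ℂ) : QLayer (AncReg a n) :=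
  ⟨[.one (Sum.inl ()) V], List.pairwise_singleton _ _⟩

theorem implements_controlQubitLayer (V : Matrix.unitaryGroup (Fin 2) ℂ) :
    Implements [controlQubitLayer a n V] (onControl V.1) := fun ψ => by
  rw [QCircuit.toMatrix_singleton, controlQubitLayer, gatesOp_cons, gatesOp_nil, mul_one,
    QGate.toMatrix_one, onControl_eq_op, ← op_mulVec_addZeroAncillas, ← QLens.op_comp,
    QLens.subregister_comp_qubit, Sum.map_inl, id]

theorem usesCnotAndSingle_controlQubitLayer (V : Matrix.unitaryGroup (Fin 2) ℂ) :
    QCircuit.UsesCnotAndSingle [controlQubitLayer a n V] := by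
  simp [QCircuit.UsesCnotAndSingle, controlQubitLayer, QGate.IsCnotOrSingle]

theorem onControl_mulVec (V : Matrix (Fin 2) (Fin 2) ℂ) (ψ : QState (CtrlReg n)) (b : Fin 2)
    (u : QBasis (Fin n)) : (onControl V).mulVec ψ (Sum.elim (fun _ => b) u)
      = ∑ c, V b c * ψ (Sum.elim (fun _ => c) u) := by
  rw [onControl_eq_op, QLens.op_mulVec]
  refine Finset.sum_congr rfl fun c _ => ?_
  have hset : (QLens.qubit (Sum.inl ())).set c (Sum.elim (fun _ => b) u : QBasis (CtrlReg n))
      = Sum.elim (fun _ => c) u := funext fun r => by cases r <;> simp [QLens.qubit]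
  rw [hset]
  rfl

theorem controlled_mulVec (U : QOp (Fin n)) (ψ : QState (CtrlReg n)) (b : Fin 2)
    (u : QBasis (Fin n)) : (controlled U).mulVec ψ (Sum.elim (fun _ => b) u)
      = ∑ w, (if b = 0 then 1 else U) u w * ψ (Sum.elim (fun _ => b) w) := by
  have hrow : (controlled U).mulVec ψ (Sum.elim (fun _ => b) u) =
      ((QLens.subregister Sum.inr_injective).op (if b = 0 then 1 else U)).mulVec ψ
        (Sum.elim (fun _ => b) u) := by
    simp only [Matrix.mulVec, dotProduct, controlled_apply, QLens.op_apply]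
    refine Finset.sum_congr rfl fun y _ => congrArg (· * ψ y) ?_
    refine if_ctx_congr Iff.rfl (fun h => ?_) fun _ => rfl
    rw [← ((extend_eq_iff Sum.inr_injective).1 h).2 (Sum.inl ()) (by simp), Sum.elim_inl]
  have hset : ∀ w, (QLens.subregister Sum.inr_injective).set w (Sum.elim (fun _ => b) u) =
      (Sum.elim (fun _ => b) w : QBasis (CtrlReg n)) := fun w => by
    simp [QLens.subregister, extend_eq_iff Sum.inr_injective]
  rw [hrow, QLens.op_mulVec]
  simp only [hset]
  rfl

theorem zeroKet_elim (b : Fin 2) (u : QBasis (Fin n)) :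
    zeroKet (CtrlReg n) (Sum.elim (fun _ => b) u) =
      if b = 0 then if u = zeroBasis (Fin n) then 1 else 0 else 0 := by
  rw [zeroKet, Pi.single_apply, ← ite_and]
  refine if_congr ?_ rfl rfl
  simp [funext_iff, zeroBasis]

theorem phaseGate_pow (j : ℕ) : phaseGate ^ j = Matrix.diagonal ![1, Complex.I ^ j] := by
  have h : phaseGate = Matrix.diagonal ![1, Complex.I] := by
    ext b c
    fin_cases b <;> fin_cases c <;> rfl
  rw [h, Matrix.diagonal_pow]
  congr 1
  ext b
  fin_cases b <;> simp

/-- The phase gate `S` as an element of the unitary group. -/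
def phaseGateUnitary : Matrix.unitaryGroup (Fin 2) ℂ :=
  ⟨phaseGate, by
    rw [Matrix.mem_unitaryGroup_iff]
    ext b c
    fin_cases b <;> fin_cases c <;> simp [Matrix.mul_apply, Matrix.star_apply, phaseGate]⟩

theorem hadamardTestOp_mulVec_zeroKet (U : QOp (Fin n)) (j : ℕ) (u : QBasis (Fin n)) :
    (hadamardTestOp U j).mulVec (zeroKet (CtrlReg n)) (Sum.elim (fun _ => 0) u) =
      (1 + Complex.I ^ j • U) u (zeroBasis (Fin n)) / 2 := by
  have hsqrt : ((√2 : ℝ) : ℂ)⁻¹ * ((√2 : ℝ) : ℂ)⁻¹ = 2⁻¹ := by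
    rw [← mul_inv, ← Complex.ofReal_mul, Real.mul_self_sqrt zero_le_two, Complex.ofReal_ofNat]
  have hH : ∀ b, hadamardGate 0 b = ((√2 : ℝ) : ℂ)⁻¹ ∧ hadamardGate b 0 = ((√2 : ℝ) : ℂ)⁻¹ := by
    simp [hadamardGate]
  have hbranch : ∀ b : Fin 2,
      (controlled U).mulVec ((onControl hadamardGate).mulVec (zeroKet (CtrlReg n)))
          (Sum.elim (fun _ => b) u) =
        (if b = 0 then 1 else U) u (zeroBasis (Fin n)) * ((√2 : ℝ) : ℂ)⁻¹ := fun b => by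
    simp [controlled_mulVec, onControl_mulVec, zeroKet_elim, (hH _).2]
  simp only [hadamardTestOp, ← Matrix.mulVec_mulVec, onControl_mulVec, hbranch, phaseGate_pow,
    Fin.sum_univ_two, (hH _).1]
  simp only [Matrix.diagonal_apply_eq, Matrix.diagonal_apply_ne, ne_eq, zero_ne_one, one_ne_zero,
    not_false_eq_true, Matrix.cons_val_zero, Matrix.cons_val_one, if_true, if_false,
    Matrix.add_apply, Matrix.smul_apply, smul_eq_mul]
  linear_combination
    ((1 : QOp (Fin n)) u (zeroBasis (Fin n)) + Complex.I ^ j * U u (zeroBasis (Fin n))) * hsqrt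

theorem probZero_eq_sum (hC : Implements C M) :
    probZero C = ∑ u : QBasis (Fin n),
      ‖M.mulVec (zeroKet (CtrlReg n)) (Sum.elim (fun _ => 0) u)‖ ^ 2 := by
  have hket : zeroKet (AncReg a n) = addZeroAncillas a (zeroKet (CtrlReg n)) := funext fun x => by
    simp only [zeroKet, addZeroAncillas, Pi.single_apply, ← ite_and]
    refine if_congr ?_ rfl rfl
    simp only [funext_iff, zeroBasis, Sum.forall, Function.comp_apply, Sum.map_inl, id_eq,
      Sum.map_inr]
    tauto
  rw [probZero, hket, hC]
  symm
  refine Fintype.sum_of_injective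
    (fun u => (Sum.elim (fun _ => 0) (Sum.elim (fun _ => 0) u) : QBasis (AncReg a n)))
    (Sum.elim_injective'.comp Sum.elim_injective') _ _ (fun x hx => ?_) fun u => ?_
  · refine ite_eq_right_iff.2 fun hctrl => ?_
    rw [addZeroAncillas, if_neg, norm_zero, sq, mul_zero]
    refine fun hanc => hx ⟨x ∘ Sum.inr ∘ Sum.inr, funext fun q => ?_⟩
    rcases q with _ | q | q
    exacts [hctrl.symm, (hanc q).symm, rfl]
  · simp [addZeroAncillas, Sum.elim_comp_map]

theorem sum_norm_sq_column {ι : Type*} [Fintype ι] (M : Matrix ι ι ℂ) (j : ι) :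
    ∑ i, ‖M i j‖ ^ 2 = ((star M * M) j j).re := by
  simp [Matrix.mul_apply, Matrix.star_apply, Complex.conj_mul', ← Complex.ofReal_pow]

theorem isHadamardTest_of_implements {j : ℕ} (hU : U ∈ Matrix.unitaryGroup (QBasis (Fin n)) ℂ)
    (hC : Implements C (hadamardTestOp U j)) : IsHadamardTest C U j := by
  set V := Complex.I ^ j • U with hVdef
  have hV : star V * V = 1 := by
    simp [V, smul_smul, Matrix.mem_unitaryGroup_iff'.1 hU, ← mul_pow]
  have hsq : star (1 + V) * (1 + V) = 1 + 1 + (V + star V) := by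
    rw [star_add, star_one, mul_add, add_mul, add_mul, hV]
    noncomm_ring
  refine ⟨hC, ?_⟩
  change _ = (1 + (V (zeroBasis (Fin n)) (zeroBasis (Fin n))).re) / 2
  simp only [probZero_eq_sum hC, hadamardTestOp_mulVec_zeroKet, ← hVdef, norm_div, div_pow,
    ← Finset.sum_div, RCLike.norm_ofNat]
  rw [sum_norm_sq_column, hsq]
  simp only [Matrix.add_apply, Matrix.one_apply_eq, Matrix.star_apply, Complex.add_re,
    Complex.one_re, RCLike.star_def, Complex.conj_re]
  ring

theorem exists_isHadamardTest (hU : U ∈ Matrix.unitaryGroup (QBasis (Fin n)) ℂ)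
    (hD : D.UsesCnotAndSingle) (hDU : Implements D (controlled U)) (j : ℕ) :
    ∃ T : QCircuit (AncReg a n), T.UsesCnotAndSingle ∧ T.depth = D.depth + 2 ∧
      IsHadamardTest T U j := by
  have hT := ((implements_controlQubitLayer hadamardUnitary).append hDU).append
    (implements_controlQubitLayer (hadamardUnitary * phaseGateUnitary ^ j))
  have hop : onControl (hadamardUnitary * phaseGateUnitary ^ j).1 *
      (controlled U * onControl hadamardUnitary.1) = hadamardTestOp U j := by
    simp only [hadamardTestOp, onControl_eq_op, ← map_mul, ← mul_assoc]
    rfl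
  refine ⟨_, ((usesCnotAndSingle_controlQubitLayer _).append hD).append
    (usesCnotAndSingle_controlQubitLayer _), ?_, isHadamardTest_of_implements hU (hop ▸ hT)⟩
  simp [QCircuit.depth]

end HadamardTest

noncomputable section TwoQubitGates

namespace QLens

variable {B C : Type*} [Fintype B] [DecidableEq B] [Fintype C] [DecidableEq C]

theorem exchange_op_mulVec (M : Matrix (C × B) (C × B) ℂ) (ψ : B × C → ℂ) (x : B × C) :
    ((exchange : QLens (B × C) (C × B)).op M).mulVec ψ x = M.mulVec (ψ ∘ Prod.swap) x.swap := by
  rw [op_mulVec]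
  rfl

end QLens

section Multiplexer

variable {ι κ : Type*} [Fintype ι] [DecidableEq ι] [Fintype κ] [DecidableEq κ]

/-- The multiplexer: `W k` is applied to the first component when the second one is `k`. -/
def multiplexer : (κ → Matrix.unitaryGroup ι ℂ) →* Matrix.unitaryGroup (ι × κ) ℂ where
  toFun W := ⟨Matrix.blockDiagonal fun k => (W k).1, by
    rw [Matrix.mem_unitaryGroup_iff, Matrix.star_eq_conjTranspose,
      Matrix.blockDiagonal_conjTranspose, ← Matrix.blockDiagonal_mul, ← Matrix.blockDiagonal_one]
    congr 1 with k : 1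
    exact Matrix.mem_unitaryGroup_iff.1 (W k).2⟩
  map_one' := Subtype.ext Matrix.blockDiagonal_one
  map_mul' V W := Subtype.ext (Matrix.blockDiagonal_mul (fun k => (V k).1) fun k => (W k).1)

theorem multiplexer_mulVec (W : κ → Matrix.unitaryGroup ι ℂ) (ψ : ι × κ → ℂ) (x : ι × κ) :
    (multiplexer W).1.mulVec ψ x = (W x.2).1.mulVec (fun i => ψ (i, x.2)) x.1 := by
  simp [multiplexer, Matrix.mulVec, dotProduct, Matrix.blockDiagonal_apply, Fintype.sum_prod_type]

theorem exchange_multiplexer_mulVec (W : κ → Matrix.unitaryGroup ι ℂ) (ψ : κ × ι → ℂ)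
    (x : κ × ι) : (QLens.exchange.opUnitary (multiplexer W)).1.mulVec ψ x
      = (W x.1).1.mulVec (fun i => ψ (x.1, i)) x.2 := by
  rw [QLens.coe_opUnitary, QLens.exchange_op_mulVec, multiplexer_mulVec]
  rfl

theorem multiplexer_mulVec_eq_self {W : κ → Matrix.unitaryGroup ι ℂ} {ψ : ι × κ → ℂ}
    (h : ∀ k, W k = 1 ∨ ∀ i, ψ (i, k) = 0) : (multiplexer W).1.mulVec ψ = ψ := by
  funext ⟨i, k⟩
  rw [multiplexer_mulVec]
  obtain hk | hk := h k
  · simp [hk]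
  · simp [hk, ← Pi.zero_def]

theorem exchange_multiplexer_mulVec_eq_self {W : κ → Matrix.unitaryGroup ι ℂ} {ψ : κ × ι → ℂ}
    (h : ∀ k, W k = 1 ∨ ∀ i, ψ (k, i) = 0) :
    (QLens.exchange.opUnitary (multiplexer W)).1.mulVec ψ = ψ := by
  funext x
  rw [QLens.coe_opUnitary, QLens.exchange_op_mulVec, multiplexer_mulVec_eq_self h,
    Function.comp_apply, Prod.swap_swap]

theorem exists_multiplexer_eq (U : Matrix.unitaryGroup (ι × κ) ℂ)
    (h : ∀ i j k l, k ≠ l → U.1 (i, k) (j, l) = 0) : ∃ W, multiplexer W = U := by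
  have hblock : Matrix.blockDiagonal U.1.blockDiag = U.1 := by
    ext x y
    rw [Matrix.blockDiagonal_apply]
    split_ifs with hxy
    · rw [Matrix.blockDiag_apply, ← Prod.mk.eta (p := y), ← hxy]
    · exact (h _ _ _ _ hxy).symm
  have hunitary : ∀ k, U.1.blockDiag k ∈ Matrix.unitaryGroup ι ℂ := fun k => by
    have hU := Matrix.mem_unitaryGroup_iff.1 U.2
    rw [← hblock, Matrix.star_eq_conjTranspose, Matrix.blockDiagonal_conjTranspose,
      ← Matrix.blockDiagonal_mul, ← Matrix.blockDiagonal_one, Matrix.blockDiagonal_inj] at hU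
    exact Matrix.mem_unitaryGroup_iff.2 (congrFun hU k)
  exact ⟨fun k => ⟨_, hunitary k⟩, Subtype.ext hblock⟩

end Multiplexer

section Synthesis

open scoped Pointwise

/-- The two-qubit unitaries performed by a single one-qubit gate or CNOT gate. -/
def elementaryUnitaries : Set (Matrix.unitaryGroup (Fin 2 × Fin 2) ℂ) :=
  Set.range QLens.first.opUnitary ∪ Set.range QLens.second.opUnitary ∪
    {cnotUnitary, QLens.exchange.opUnitary cnotUnitary}

theorem exchange_mem_elementaryUnitaries {U : Matrix.unitaryGroup (Fin 2 × Fin 2) ℂ}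
    (h : U ∈ elementaryUnitaries) : QLens.exchange.opUnitary U ∈ elementaryUnitaries := by
  obtain (⟨V, rfl⟩ | ⟨V, rfl⟩) | rfl | rfl := h
  · exact .inl (.inr ⟨V, QLens.opUnitary_comp QLens.exchange QLens.first V⟩)
  · exact .inl (.inl ⟨V, QLens.opUnitary_comp QLens.exchange QLens.second V⟩)
  · exact .inr (.inr rfl)
  · refine .inr (.inl (Subtype.ext (Matrix.mulVec_injective (funext fun ψ => funext fun x => ?_))))
    simp only [QLens.coe_opUnitary, QLens.exchange_op_mulVec]
    rfl

theorem exchange_mem_elementaryUnitaries_pow {U : Matrix.unitaryGroup (Fin 2 × Fin 2) ℂ} {k : ℕ}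
    (h : U ∈ elementaryUnitaries ^ k) :
    QLens.exchange.opUnitary U ∈ elementaryUnitaries ^ k := by
  refine Set.pow_subset_pow_left (Set.image_subset_iff.2 fun V hV => ?_)
    (Set.image_pow QLens.exchange.opUnitary elementaryUnitaries k ▸ Set.mem_image_of_mem _ h)
  exact exchange_mem_elementaryUnitaries hV

theorem first_opUnitary_eq_multiplexer (V : Matrix.unitaryGroup (Fin 2) ℂ) :
    QLens.first.opUnitary V = multiplexer fun _ : Fin 2 => V := by
  refine Subtype.ext (Matrix.mulVec_injective (funext fun ψ => funext fun x => ?_))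
  rw [multiplexer_mulVec, QLens.coe_opUnitary, QLens.op_mulVec]
  rfl

theorem exchange_cnotUnitary_eq_multiplexer :
    QLens.exchange.opUnitary cnotUnitary = multiplexer ![1, pauliX] := by
  refine Subtype.ext (Matrix.mulVec_injective (funext fun ψ => funext fun ⟨i, j⟩ => ?_))
  rw [multiplexer_mulVec, QLens.coe_opUnitary, QLens.exchange_op_mulVec, cnotUnitary_mulVec]
  fin_cases i <;> fin_cases j <;> simp [pauliX, Matrix.mulVec, dotProduct]

theorem multiplexer_eq_of_abc {W : Fin 2 → Matrix.unitaryGroup (Fin 2) ℂ}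
    {A B C : Matrix.unitaryGroup (Fin 2) ℂ} {z : Circle} (h₀ : A * B * C = 1)
    (h₁ : (z : ℂ) • (A * pauliX * B * pauliX * C).1 = (W 1 * (W 0)⁻¹).1) :
    multiplexer W = QLens.first.opUnitary A * QLens.exchange.opUnitary cnotUnitary *
      QLens.first.opUnitary B * QLens.exchange.opUnitary cnotUnitary * QLens.first.opUnitary C *
      QLens.second.opUnitary (phaseUnitary z) * QLens.first.opUnitary (W 0) := by
  have hW : ∀ k, (W k).1 = (if k = 0 then 1 else (z : ℂ)) •
      (A * ((![1, pauliX] : Fin 2 → _) k * (B * ((![1, pauliX] : Fin 2 → _) k * (C * W 0))))).1 :=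
    Fin.forall_fin_two.2
      ⟨by simp [← mul_assoc, h₀],
       by
        rw [← inv_mul_cancel_right (W 1) (W 0), Matrix.UnitaryGroup.mul_val _ (W 0), ← h₁,
          Matrix.smul_mul, ← Matrix.UnitaryGroup.mul_val]
        simp [mul_assoc]⟩
  refine Subtype.ext (Matrix.mulVec_injective (funext fun ψ => funext fun ⟨i, k⟩ => ?_))
  simp only [first_opUnitary_eq_multiplexer, exchange_cnotUnitary_eq_multiplexer,
    Matrix.UnitaryGroup.mul_val, ← Matrix.mulVec_mulVec, multiplexer_mulVec, QLens.coe_opUnitary,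
    QLens.op_phaseUnitary_mulVec]
  change _ = A.1.mulVec (((![1, pauliX] : Fin 2 → _) k).1.mulVec (B.1.mulVec
    (((![1, pauliX] : Fin 2 → _) k).1.mulVec (C.1.mulVec
      ((if k = 0 then 1 else (z : ℂ)) • (W 0).1.mulVec fun i => ψ (i, k)))))) i
  simp only [hW k, Matrix.UnitaryGroup.mul_val, ← Matrix.mulVec_mulVec, Matrix.smul_mulVec,
    Matrix.mulVec_smul]

theorem multiplexer_mem_elementaryUnitaries_pow (W : Fin 2 → Matrix.unitaryGroup (Fin 2) ℂ) :
    multiplexer W ∈ elementaryUnitaries ^ 7 := by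
  obtain ⟨A, B, C, z, h₀, h₁⟩ := exists_abc (W 1 * (W 0)⁻¹)
  have hfirst : ∀ V, QLens.first.opUnitary V ∈ elementaryUnitaries := fun V => .inl (.inl ⟨V, rfl⟩)
  have hsecond : ∀ V, QLens.second.opUnitary V ∈ elementaryUnitaries :=
    fun V => .inl (.inr ⟨V, rfl⟩)
  have hcnot : QLens.exchange.opUnitary cnotUnitary ∈ elementaryUnitaries := .inr (.inr rfl)
  rw [multiplexer_eq_of_abc h₀ h₁]
  simp only [pow_succ, pow_zero, one_mul]
  exact Set.mul_mem_mul (Set.mul_mem_mul (Set.mul_mem_mul (Set.mul_mem_mul (Set.mul_mem_mul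
    (Set.mul_mem_mul (hfirst A) hcnot) (hfirst B)) hcnot) (hfirst C)) (hsecond _)) (hfirst _)

theorem inv_exchange_multiplexer_mul_multiplexer_mem
    (V W : Fin 2 → Matrix.unitaryGroup (Fin 2) ℂ) :
    (QLens.exchange.opUnitary (multiplexer V) * multiplexer W)⁻¹ ∈ elementaryUnitaries ^ 14 := by
  rw [mul_inv_rev, ← map_inv, ← map_inv, ← map_inv]
  exact pow_add elementaryUnitaries 7 7 ▸ Set.mul_mem_mul
    (multiplexer_mem_elementaryUnitaries_pow _)
    (exchange_mem_elementaryUnitaries_pow (multiplexer_mem_elementaryUnitaries_pow _))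

theorem exists_mulVec_eq_zero_of_ne (ψ : Fin 2 × Fin 2 → ℂ) :
    ∃ G : Matrix.unitaryGroup (Fin 2 × Fin 2) ℂ, G⁻¹ ∈ elementaryUnitaries ^ 14 ∧
      ∀ x, x ≠ (0, 0) → G.1.mulVec ψ x = 0 := by
  choose W hW using fun k => exists_unitary_mulVec_one_eq_zero fun i => ψ (i, k)
  set φ := (multiplexer W).1.mulVec ψ with hφ
  have hφ₁ : ∀ k, φ (1, k) = 0 := fun k => by rw [hφ, multiplexer_mulVec, hW]
  obtain ⟨V, hV⟩ := exists_unitary_mulVec_one_eq_zero fun j => φ (0, j)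
  refine ⟨_, inv_exchange_multiplexer_mul_multiplexer_mem ![V, 1] W, fun ⟨i, j⟩ hx => ?_⟩
  rw [Matrix.UnitaryGroup.mul_val, ← Matrix.mulVec_mulVec, ← hφ, exchange_multiplexer_mulVec]
  obtain rfl | rfl : i = 0 ∨ i = 1 := by omega
  · obtain rfl : j = 1 := by grind
    exact hV
  · simp [hφ₁]

theorem exists_mulVec_eq_zero_of_ne_of_apply_eq_zero {ψ : Fin 2 × Fin 2 → ℂ} (hψ : ψ (0, 0) = 0) :
    ∃ G : Matrix.unitaryGroup (Fin 2 × Fin 2) ℂ, G⁻¹ ∈ elementaryUnitaries ^ 14 ∧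
      (∀ φ, (∀ x, x ≠ (0, 0) → φ x = 0) → G.1.mulVec φ = φ) ∧
      ∀ x, x ≠ (1, 0) → G.1.mulVec ψ x = 0 := by
  obtain ⟨W, hW⟩ := exists_unitary_mulVec_one_eq_zero fun i => ψ (i, 1)
  set χ := (multiplexer ![1, pauliX * W]).1.mulVec ψ with hχ
  have hχ₀ : ∀ j, χ (0, j) = 0 := by
    simp only [hχ, multiplexer_mulVec, Fin.forall_fin_two]
    refine ⟨by simp [hψ], ?_⟩
    change (pauliX.1 * W.1).mulVec _ 0 = 0
    rw [← Matrix.mulVec_mulVec]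
    simpa [pauliX, Matrix.mulVec, dotProduct] using hW
  obtain ⟨V, hV⟩ := exists_unitary_mulVec_one_eq_zero fun j => χ (1, j)
  refine ⟨_, inv_exchange_multiplexer_mul_multiplexer_mem ![1, V] ![1, pauliX * W], fun φ hφ => ?_,
    fun ⟨i, j⟩ hx => ?_⟩ <;>
    rw [Matrix.UnitaryGroup.mul_val, ← Matrix.mulVec_mulVec]
  · rw [multiplexer_mulVec_eq_self, exchange_multiplexer_mulVec_eq_self] <;>
      simp [Fin.forall_fin_two, hφ]
  · rw [← hχ, exchange_multiplexer_mulVec]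
    obtain rfl | rfl : i = 0 ∨ i = 1 := by omega
    · simp [hχ₀]
    · obtain rfl : j = 1 := by grind
      exact hV

theorem mem_elementaryUnitaries_pow (U : Matrix.unitaryGroup (Fin 2 × Fin 2) ℂ) :
    U ∈ elementaryUnitaries ^ 35 := by
  obtain ⟨G, hG, hG₀⟩ := exists_mulVec_eq_zero_of_ne fun x => U.1 x (0, 0)
  have hψ : (G * U).1 (0, 0) (1, 0) = 0 := row_eq_zero_of_column_eq_zero (G * U) hG₀ (by simp)
  obtain ⟨H, hH, hH₀, hH₁⟩ := exists_mulVec_eq_zero_of_ne_of_apply_eq_zero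
    (ψ := fun x => (G * U).1 x (1, 0)) hψ
  set B := H * (G * U)
  have hB : ∀ k x, x ≠ (k, 0) → B.1 x (k, 0) = 0 := Fin.forall_fin_two.2
    ⟨fun x hx => (congrFun (hH₀ (fun x => (G * U).1 x (0, 0)) hG₀) x).trans (hG₀ x hx), hH₁⟩
  obtain ⟨W, hW⟩ := exists_multiplexer_eq B fun i j k l hkl => by
    obtain rfl | rfl : l = 0 ∨ k = 0 := by omega
    · exact hB j _ (by simp [hkl])
    · exact row_eq_zero_of_column_eq_zero B (hB i) (by simp [hkl.symm])
  have hU : U = G⁻¹ * (H⁻¹ * multiplexer W) := by simp [hW, B]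
  rw [hU]
  exact pow_add elementaryUnitaries 14 21 ▸ Set.mul_mem_mul hG
    (pow_add elementaryUnitaries 14 7 ▸ Set.mul_mem_mul hH
      (multiplexer_mem_elementaryUnitaries_pow W))

end Synthesis

theorem QCircuit.toMatrix_reverse {Q : Type} [Fintype Q] [DecidableEq Q] (C : QCircuit Q) :
    toMatrix C.reverse = (C.map QLayer.toMatrix).prod := by
  induction C with
  | nil => rfl
  | cons L C ih =>
    rw [List.reverse_cons, toMatrix_append, ih, toMatrix_singleton, List.map_cons, List.prod_cons]
    rfl

section Synthesis

open scoped Pointwise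

variable {Q : Type} [Fintype Q] [DecidableEq Q]

theorem exists_gate_of_mem_elementaryUnitaries {p q : Q} (h : p ≠ q)
    {U : Matrix.unitaryGroup (Fin 2 × Fin 2) ℂ} (hU : U ∈ elementaryUnitaries) :
    ∃ g : QGate Q, g.IsCnotOrSingle ∧ g.support ⊆ {p, q} ∧
      g.toMatrix = (QLens.pair h).op U.1 := by
  obtain (⟨V, rfl⟩ | ⟨V, rfl⟩) | rfl | rfl := hU
  · refine ⟨.one p V, trivial, by simp [QGate.support], ?_⟩
    rw [QGate.toMatrix_one, ← QLens.pair_comp_first h, QLens.op_comp, QLens.coe_opUnitary]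
  · refine ⟨.one q V, trivial, by simp [QGate.support], ?_⟩
    rw [QGate.toMatrix_one, ← QLens.pair_comp_second h, QLens.op_comp, QLens.coe_opUnitary]
  · exact ⟨.two p q h cnotUnitary, rfl, subset_rfl, QGate.toMatrix_two h _⟩
  · refine ⟨.two q p h.symm cnotUnitary, rfl, (Finset.pair_comm q p).subset, ?_⟩
    rw [QGate.toMatrix_two, ← QLens.pair_comp_exchange h, QLens.op_comp, QLens.coe_opUnitary]

theorem QGate.exists_ofFn_toMatrix_prod_eq (g : QGate Q) :
    ∃ w : Fin 35 → QGate Q, (∀ i, (w i).IsCnotOrSingle) ∧ (∀ i, (w i).support ⊆ g.support) ∧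
      ((List.finRange 35).map fun i => (w i).toMatrix).prod = g.toMatrix := by
  cases g with
  | one q U =>
    refine ⟨Fin.cons (one q U) fun _ => one q 1, Fin.cases trivial fun _ => trivial,
      Fin.cases subset_rfl fun _ => subset_rfl, ?_⟩
    have hid : (one q 1).toMatrix = 1 := by
      rw [toMatrix_one, OneMemClass.coe_one, map_one]
    rw [List.finRange_succ, List.map_cons, List.prod_cons, List.map_map, Fin.cons_zero]
    simp only [Function.comp_def, Fin.cons_succ, hid, List.map_const', List.prod_replicate,
      one_pow, mul_one]
  | two p q h U =>
    obtain ⟨f, hf⟩ := Set.mem_pow.1 (mem_elementaryUnitaries_pow U)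
    choose w hw₁ hw₂ hw₃ using fun i => exists_gate_of_mem_elementaryUnitaries h (f i).2
    refine ⟨w, hw₁, hw₂, ?_⟩
    rw [toMatrix_two, ← hf, List.ofFn_eq_map, Submonoid.coe_list_prod, map_list_prod,
      List.map_map, List.map_map]
    simp only [hw₃, Function.comp_def]

theorem exists_cnotAndSingle_layers (L : QLayer Q) :
    ∃ D : QCircuit Q, D.UsesCnotAndSingle ∧ D.depth = 35 ∧ D.toMatrix = L.toMatrix := by
  choose w hw hsupp hprod using QGate.exists_ofFn_toMatrix_prod_eq (Q := Q)
  have hdisj : ∀ i j, L.gates.Pairwise fun g h => Disjoint (w g i).support (w h j).support :=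
    fun i j => L.disjoint.imp fun h => h.mono (hsupp _ i) (hsupp _ j)
  let layer (i : Fin 35) : QLayer Q := ⟨L.gates.map (w · i), List.pairwise_map.2 (hdisj i i)⟩
  refine ⟨((List.finRange 35).map layer).reverse, ?_, by simp [QCircuit.depth], ?_⟩
  · simp only [QCircuit.UsesCnotAndSingle, List.mem_reverse, List.forall_mem_map, layer]
    exact fun i _ g _ => hw g i
  · have hcomm := prod_map_prod_map_comm (M' := fun i g => (w g i).toMatrix)
      (L.disjoint.imp fun h i j => QGate.commute_toMatrix
        (h.symm.mono (hsupp _ i) (hsupp _ j))) (List.finRange 35)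
    simp only [hprod] at hcomm
    rw [QCircuit.toMatrix_reverse, List.map_map]
    simpa only [QLayer.toMatrix, layer, Function.comp_def, List.map_map] using hcomm

theorem exists_cnotAndSingle_circuit (C : QCircuit Q) :
    ∃ D : QCircuit Q, D.UsesCnotAndSingle ∧ D.depth = 35 * C.depth ∧ D.toMatrix = C.toMatrix := by
  induction C with
  | nil => exact ⟨[], by simp [QCircuit.UsesCnotAndSingle], rfl, rfl⟩
  | cons L C ih =>
    obtain ⟨D, hD, hdepthD, hDC⟩ := ih
    obtain ⟨E, hE, hdepthE, hEL⟩ := exists_cnotAndSingle_layers L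
    refine ⟨E ++ D, hE.append hD, ?_, ?_⟩
    · rw [QCircuit.depth_append, hdepthE, hdepthD, QCircuit.depth, QCircuit.depth,
        List.length_cons, Nat.mul_succ, Nat.add_comm]
    · rw [QCircuit.toMatrix_append, hDC, hEL, QCircuit.toMatrix]

end Synthesis

end TwoQubitGates

theorem ceil_logb_le_two_mul {s : ℕ} (hs : 1 ≤ s) :
    (⌈Real.logb 2 (s : ℝ)⌉₊ : ℝ) ≤ 2 * Real.logb 2 (s : ℝ) := by
  rcases hs.eq_or_lt with rfl | hs
  · simp
  · have hone : 1 ≤ Real.logb 2 (s : ℝ) := by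
      rw [Real.le_logb_iff_rpow_le (by norm_num) (by positivity), Real.rpow_one]
      exact_mod_cast hs
    linarith [Nat.ceil_lt_add_one (zero_le_one.trans hone)]

theorem logb_natCast_nonneg (s : ℕ) : 0 ≤ Real.logb 2 (s : ℝ) :=
  div_nonneg (Real.log_natCast_nonneg s) (Real.log_nonneg one_le_two)

section Rate

variable {n s : ℕ}

theorem logb_ratio_nonneg (hs : 1 ≤ s) (hsn : s ≤ n) : 0 ≤ Real.logb 2 ((n : ℝ) / (s : ℝ)) := by
  refine Real.logb_nonneg one_lt_two ?_
  rw [one_le_div (by exact_mod_cast hs)]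
  exact_mod_cast hsn

theorem natCast_le_depthRate (hs : 1 ≤ s) (hsn : s ≤ n) (d : ℕ) :
    (d : ℝ) ≤ depthRate n s d :=
  le_add_of_nonneg_left <| add_nonneg (logb_natCast_nonneg s) <|
    mul_nonneg d.cast_nonneg (logb_ratio_nonneg hs hsn)

theorem controlDepth_le_mul_depthRate (hs : 1 ≤ s) (hsn : s ≤ n) (d : ℕ) :
    (controlDepth n s d : ℝ) ≤ 21 * depthRate n s d := by
  have hratio := logb_ratio_nonneg hs hsn
  have hceil := mul_le_mul_of_nonneg_left (Nat.ceil_lt_add_one hratio).le (d.cast_nonneg (α := ℝ))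
  have hrate := mul_nonneg (d.cast_nonneg (α := ℝ)) hratio
  rw [controlDepth, depthRate]
  push_cast
  linarith [ceil_logb_le_two_mul hs, logb_natCast_nonneg s]

end Rate

theorem controlDepth_mul_le (n s d : ℕ) {c : ℕ} (hc : 1 ≤ c) :
    controlDepth n s (c * d) ≤ c * controlDepth n s d := by
  rw [controlDepth, controlDepth]
  nlinarith [Nat.mul_le_mul_right (2 * ⌈Real.logb 2 (s : ℝ)⌉₊) hc]

/-- There is an absolute constant `K` such that for all `n`, all `s` with `1 ≤ s ≤ n` and all `d`
the following hold, with `s - 1` ancillas and hence `n + s` qubits throughout.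
(1) `2⌈log s⌉ + 12 d ⌈log (n/s)⌉ + 9 d` is at most `K (log s + d log (n/s) + d)`.
(2) For a depth-`d` circuit `C` of CNOT and single-qubit gates, Control-`C` has a circuit of CNOT
and single-qubit gates of depth at most `2⌈log s⌉ + 12 d ⌈log (n/s)⌉ + 9 d`, and the Hadamard tests
of `{|0ⁿ⟩, C}` have such circuits with two additional layers.
(3) For a depth-`d` circuit `C` of arbitrary one- and two-qubit gates, Control-`C` and (for `d ≥ 1`)
the Hadamard tests of `{|0ⁿ⟩, C}` have circuits of CNOT and single-qubit gates of depth at most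
`K (log s + d log (n/s) + d)`. -/
theorem mainTheorem5 :
    ∃ K : ℝ, ∀ n s d : ℕ, 1 ≤ s → s ≤ n →
      ((controlDepth n s d : ℝ) ≤ K * depthRate n s d) ∧
      (∀ C : QCircuit (Fin n), C.depth = d → C.UsesCnotAndSingle →
        (∃ D : QCircuit (AncReg (s - 1) n), D.UsesCnotAndSingle ∧
          D.depth ≤ controlDepth n s d ∧ Implements D (controlled C.toMatrix)) ∧
        (∀ j : ℕ, ∃ T : QCircuit (AncReg (s - 1) n), T.UsesCnotAndSingle ∧
          T.depth ≤ controlDepth n s d + 2 ∧ IsHadamardTest T C.toMatrix j)) ∧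
      (∀ C : QCircuit (Fin n), C.depth = d →
        (∃ D : QCircuit (AncReg (s - 1) n), D.UsesCnotAndSingle ∧
          (D.depth : ℝ) ≤ K * depthRate n s d ∧ Implements D (controlled C.toMatrix)) ∧
        (1 ≤ d → ∀ j : ℕ, ∃ T : QCircuit (AncReg (s - 1) n), T.UsesCnotAndSingle ∧
          (T.depth : ℝ) ≤ K * depthRate n s d ∧ IsHadamardTest T C.toMatrix j)) := by
  refine ⟨737, fun n s d hs hsn => ?_⟩
  have hd := natCast_le_depthRate hs hsn d
  have hd_nonneg : (0 : ℝ) ≤ d := d.cast_nonneg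
  have hcontrol := controlDepth_le_mul_depthRate hs hsn d
  refine ⟨by linarith, ?_, ?_⟩
  · rintro C rfl hC
    obtain ⟨D, hD, hdepth, himpl⟩ := exists_implements_controlled hs hC
    refine ⟨⟨D, hD, hdepth, himpl⟩, fun j => ?_⟩
    obtain ⟨T, hT, hdepthT, htest⟩ := exists_isHadamardTest C.toMatrix_mem_unitaryGroup hD himpl j
    exact ⟨T, hT, by omega, htest⟩
  · rintro C rfl
    obtain ⟨C', hC', hdepthC', hCC'⟩ := exists_cnotAndSingle_circuit C
    obtain ⟨D, hD, hdepth, himpl⟩ := exists_implements_controlled hs hC'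
    rw [hdepthC'] at hdepth
    rw [hCC'] at himpl
    -- `737 = 35 * 21 + 2`
    have hdepthD : (D.depth : ℝ) ≤ 35 * controlDepth n s C.depth := by
      exact_mod_cast hdepth.trans (controlDepth_mul_le n s C.depth (by norm_num))
    refine ⟨⟨D, hD, by linarith, himpl⟩, fun hpos j => ?_⟩
    obtain ⟨T, hT, hdepthT, htest⟩ := exists_isHadamardTest C.toMatrix_mem_unitaryGroup hD himpl j
    have hpos' : (1 : ℝ) ≤ C.depth := by exact_mod_cast hpos
    refine ⟨T, hT, ?_, htest⟩
    rw [hdepthT, Nat.cast_add, Nat.cast_two]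
    linarith
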